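/- For a group $G$, let $c(G)$ be the Matveev–Pervova complexity of $G$, that is, the minimal length $\sum_{i=1}^m |r_i|$ of a finite presentation $\langle a_1,\dots,a_n \mid r_1,\dots,r_m\rangle$ of $G$, where $|\cdot|$ is the word length in the free group on $a_1,\dots,a_n$. Let $h(G)$ be the minimal number $m$ of relators of a finite presentation of $G$. Let $\kappa(G)$ be the simplicial complexity of $G$, that is, the minimal number of $2$-simplices of a finite connected simplicial complex of dimension at most $2$ with fundamental group isomorphic to $G$. (A minimum over an empty family is $+\infty$; this concerns only groups that are not finitely presentable.) For every group $G$, $$\frac{\kappa(G)+h(G)}{6}\;\le\; c(G),$$ and, if $G$ is not a free group (the trivial group counts as free), then $$c(G)\;\le\; 3\,(\kappa(G)-4).$$ -/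

import Mathlib

open scoped ENNReal

/-- A finite abstract simplicial complex of dimension at most `2`. -/
structure FiniteTwoComplex where
  /-- the vertices -/
  V : Type
  /-- there are finitely many vertices -/
  [fintypeV : Fintype V]
  /-- the simplices, given by their sets of vertices; every vertex is a `0`-simplex -/
  K : AbstractSimplicialComplex V
  /-- every simplex has dimension at most `2` -/
  card_le_three : ∀ s ∈ K.faces, s.card ≤ 3

attribute [instance] FiniteTwoComplex.fintypeV

namespace FiniteTwoComplex

/-- The geometric realization, in barycentric coordinates: the points of the standard simplex on
the vertex set whose coordinates vanish off some simplex of the complex. -/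
def realization (X : FiniteTwoComplex) : Set (X.V → ℝ) :=
  {x | x ∈ stdSimplex ℝ X.V ∧ ∃ s ∈ X.K.faces, ∀ v, v ∉ s → x v = 0}

/-- The number `s₂(X)` of `2`-simplices. -/
noncomputable def numTriangles (X : FiniteTwoComplex) : ℕ :=
  {s : Finset X.V | s ∈ X.K.faces ∧ s.card = 3}.ncard

/-- `X` is connected and its (topological) fundamental group is isomorphic to `G`. -/
def HasFundamentalGroup (X : FiniteTwoComplex) (G : Type*) [Group G] : Prop :=
  PathConnectedSpace X.realization ∧
    ∃ x : X.realization, Nonempty (FundamentalGroup X.realization x ≃* G)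

end FiniteTwoComplex

/-- A finite presentation `⟨a₁, …, aₙ ∣ r₁, …, rₘ⟩` of the group `G`. -/
structure FinPresentation (G : Type*) [Group G] where
  /-- number of generators -/
  n : ℕ
  /-- number of relators -/
  m : ℕ
  /-- the relators -/
  rel : Fin m → FreeGroup (Fin n)
  /-- the group presented is `G` -/
  equiv : PresentedGroup (Set.range rel) ≃* G

/-- The length of a presentation: the sum of the word lengths of its relators. -/
def FinPresentation.length {G : Type*} [Group G] (P : FinPresentation G) : ℕ :=
  ∑ i, (P.rel i).norm

/-- The simplicial complexity `κ(G)`: the infimum of the number of `2`-simplices over all finite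
connected simplicial `2`-complexes with fundamental group `G` (`⊤` if there are none). -/
noncomputable def simplicialComplexity (G : Type*) [Group G] : ℕ∞ :=
  ⨅ (X : FiniteTwoComplex) (_ : X.HasFundamentalGroup G), (X.numTriangles : ℕ∞)

/-- The Matveev–Pervova complexity `c(G)`: the minimal length of a finite presentation of `G`
(`⊤` if there are none). -/
noncomputable def cComplexity (G : Type*) [Group G] : ℕ∞ :=
  ⨅ P : FinPresentation G, (P.length : ℕ∞)

/-- The minimal number `h` of relators of a finite presentation of `G` (`⊤` if there are none). -/
noncomputable def minRelators (G : Type*) [Group G] : ℕ∞ :=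
  ⨅ P : FinPresentation G, (P.m : ℕ∞)

/-
The edge-path group of a finite `2`-complex is its fundamental group: an edge cocycle with values
in a group `H` defines a covering with fibre `H`, and path lifting turns it into a homomorphism
from the fundamental group to `H`.

Upper bound. Collapsing a spanning tree presents `π₁` with one relator of length at most `3` per
triangle. If the tree contains all edges at a vertex `v`, every triangle at `v` only kills a
generator and may be dropped; a complex with the least number of triangles for a group that is not
free has a vertex on at least four triangles, which leaves `3 (κ - 4)`.

Lower bound. A relator of length `k` is a polygon with `k` sides, each subdivided into three edges
because it is glued to a loop; such a polygon can be triangulated with `6 k - 1` triangles, and the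
`-1` for each relator accounts for `h(G)`.
-/

open scoped unitInterval Topology

section PathClasses

open Path

variable {Y : Type*} [TopologicalSpace Y]

theorem pathClass_eq_of_range_subset (S : Set Y) [SimplyConnectedSpace S] {x y : Y}
    (γ δ : Path x y) (hγ : Set.range γ ⊆ S) (hδ : Set.range δ ⊆ S) :
    Homotopic.Quotient.mk γ = Homotopic.Quotient.mk δ := by
  have hγ' (t : I) : γ t ∈ S := hγ ⟨t, rfl⟩
  have hδ' (t : I) : δ t ∈ S := hδ ⟨t, rfl⟩
  have hx : x ∈ S := by simpa using hγ' 0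
  have hy : y ∈ S := by simpa using hγ' 1
  let γ' : Path (⟨x, hx⟩ : S) ⟨y, hy⟩ :=
    { toFun := fun t => ⟨γ t, hγ' t⟩, source' := by simp, target' := by simp }
  let δ' : Path (⟨x, hx⟩ : S) ⟨y, hy⟩ :=
    { toFun := fun t => ⟨δ t, hδ' t⟩, source' := by simp, target' := by simp }
  exact Homotopic.Quotient.eq.mpr
    ((SimplyConnectedSpace.paths_homotopic γ' δ').map ⟨Subtype.val, continuous_subtype_val⟩)

theorem pathClass_symm_trans_cancel {x y z : Y} (p : Homotopic.Quotient x y)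
    (q : Homotopic.Quotient y z) : p.symm.trans (p.trans q) = q := by
  rw [← Homotopic.Quotient.trans_assoc, Homotopic.Quotient.symm_trans,
    Homotopic.Quotient.refl_trans]

theorem pathClass_symm_refl (x : Y) :
    (Homotopic.Quotient.refl x).symm = Homotopic.Quotient.refl x := by
  simpa using Homotopic.Quotient.symm_trans (Homotopic.Quotient.refl x)

theorem pathClass_induction_of_isOpen_cover {ι : Type*} {U : ι → Set Y} (hU : ∀ i, IsOpen (U i))
    (hcov : ∀ y, ∃ i, y ∈ U i) {P : ∀ x y : Y, Homotopic.Quotient x y → Prop}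
    (mk : ∀ (i : ι) (x y : Y) (γ : Path x y), Set.range γ ⊆ U i →
      P x y (Homotopic.Quotient.mk γ))
    (trans : ∀ (x y z : Y) (p : Homotopic.Quotient x y) (q : Homotopic.Quotient y z),
      P x y p → P y z q → P x z (p.trans q))
    {x y : Y} (p : Homotopic.Quotient x y) : P x y p := by
  induction p using Homotopic.Quotient.ind with | mk γ => ?_
  obtain ⟨t, ht0, htm, ⟨n, hn⟩, ht⟩ := exists_monotone_Icc_subset_open_cover_unitInterval
    (c := fun i => γ ⁻¹' U i) (fun i => (hU i).preimage γ.continuous)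
    (fun s _ => by simpa using hcov (γ s))
  have piece (i : ι) (a b : I) (hab : a ≤ b) (h : Set.Icc a b ⊆ γ ⁻¹' U i) :
      P _ _ (Homotopic.Quotient.mk (γ.subpath a b)) := by
    refine mk i _ _ _ ?_
    rwa [Path.range_subpath_of_le _ _ _ hab, Set.image_subset_iff]
  have initial (k : ℕ) : P _ _ (Homotopic.Quotient.mk (γ.subpath (t 0) (t k))) := by
    induction k with
    | zero =>
      obtain ⟨i, hi⟩ := hcov (γ (t 0))
      exact piece i _ _ le_rfl (by simpa using hi)
    | succ k ih =>
      obtain ⟨i, hi⟩ := ht k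
      have h := trans _ _ _ _ _ ih (piece i _ _ (htm k.le_succ) hi)
      rwa [← Homotopic.Quotient.mk_trans,
        Homotopic.Quotient.eq.mpr ⟨Path.Homotopy.subpathTransSubpath γ _ _ _⟩] at h
  have uncast (x' y' : Y) (hx : x' = x) (hy : y' = y)
      (h : P x' y' (Homotopic.Quotient.mk (γ.cast hx hy))) : P x y (Homotopic.Quotient.mk γ) := by
    subst hx hy
    exact h
  have whole := initial n
  rw [ht0, hn n le_rfl, Path.subpath_zero_one] at whole
  exact uncast _ _ _ _ whole

end PathClasses

section SimplicialComplexes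

variable {V : Type*} (K : AbstractSimplicialComplex V)

/-- The vertices `a` and `b`, possibly equal, lie in a common simplex of `K`. -/
def SpansEdge (a b : V) : Prop := ∃ s ∈ K.faces, a ∈ s ∧ b ∈ s

/-- The vertices `a`, `b` and `c`, possibly equal, lie in a common simplex of `K`. -/
def SpansFace (a b c : V) : Prop := ∃ s ∈ K.faces, a ∈ s ∧ b ∈ s ∧ c ∈ s

/-- A `1`-cocycle of `K` with values in a group: a labelling of the ordered pairs of vertices that
is multiplicative on the simplices of `K`. Labels of pairs outside `K` carry no meaning. -/
def IsEdgeCocycle {H : Type*} [Group H] (ℓ : V → V → H) : Prop :=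
  ∀ a b c, SpansFace K a b c → ℓ a b * ℓ b c = ℓ a c

/-- `p` is the parent function of a spanning tree, rooted at `r`, of the `1`-skeleton of `K`. The
height function `d` excludes cycles. -/
def IsSpanningTree (r : V) (p : V → V) : Prop :=
  ∃ d : V → ℕ, ∀ v, v ≠ r → SpansEdge K v (p v) ∧ d (p v) < d v

/-- A `1`-cocycle of `K` that is trivial along the tree with parent function `p`. -/
structure IsTreeCocycle {H : Type*} [Group H] (r : V) (p : V → V) (ℓ : V → V → H) : Prop where
  isEdgeCocycle : IsEdgeCocycle K ℓ
  parent_eq_one : ∀ v, v ≠ r → ℓ v (p v) = 1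

variable {K}

theorem SpansEdge.symm {a b : V} : SpansEdge K a b → SpansEdge K b a :=
  fun ⟨s, hs, ha, hb⟩ => ⟨s, hs, hb, ha⟩

theorem SpansEdge.refl (a : V) : SpansEdge K a a :=
  ⟨{a}, K.singleton_mem a, by simp, by simp⟩

theorem SpansEdge.spansFace {a b : V} : SpansEdge K a b → SpansFace K a b a :=
  fun ⟨s, hs, ha, hb⟩ => ⟨s, hs, ha, hb, ha⟩

theorem spansEdge_iff [DecidableEq V] {a b : V} : SpansEdge K a b ↔ {a, b} ∈ K.faces := by
  refine ⟨fun ⟨s, hs, ha, hb⟩ => ?_, fun h => ⟨_, h, by simp, by simp⟩⟩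
  exact K.isRelLowerSet_faces.mem_of_le hs (by simp [Finset.insert_subset_iff, ha, hb]) (by simp)

namespace SpansFace

variable {a b c : V}

theorem left : SpansFace K a b c → SpansEdge K a b := fun ⟨s, hs, ha, hb, _⟩ => ⟨s, hs, ha, hb⟩

theorem right : SpansFace K a b c → SpansEdge K b c := fun ⟨s, hs, _, hb, hc⟩ => ⟨s, hs, hb, hc⟩

theorem outer : SpansFace K a b c → SpansEdge K a c := fun ⟨s, hs, ha, _, hc⟩ => ⟨s, hs, ha, hc⟩

theorem rotate : SpansFace K a b c → SpansFace K b c a :=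
  fun ⟨s, hs, ha, hb, hc⟩ => ⟨s, hs, hb, hc, ha⟩

theorem reverse : SpansFace K a b c → SpansFace K c b a :=
  fun ⟨s, hs, ha, hb, hc⟩ => ⟨s, hs, hc, hb, ha⟩

theorem swap : SpansFace K a b c → SpansFace K b a c :=
  fun ⟨s, hs, ha, hb, hc⟩ => ⟨s, hs, hb, ha, hc⟩

end SpansFace

theorem spansFace_iff [DecidableEq V] {a b c : V} :
    SpansFace K a b c ↔ {a, b, c} ∈ K.faces := by
  refine ⟨fun ⟨s, hs, ha, hb, hc⟩ => ?_, fun h => ⟨_, h, by simp, by simp, by simp⟩⟩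
  exact K.isRelLowerSet_faces.mem_of_le hs (by simp [Finset.insert_subset_iff, ha, hb, hc])
    (by simp)

namespace IsEdgeCocycle

variable {H : Type*} [Group H] {ℓ : V → V → H}

theorem self (h : IsEdgeCocycle K ℓ) (a : V) : ℓ a a = 1 := by
  simpa using h a a a (SpansEdge.refl a).spansFace

theorem swap (h : IsEdgeCocycle K ℓ) {a b : V} (hab : SpansEdge K a b) :
    ℓ b a = (ℓ a b)⁻¹ := by
  rw [eq_inv_iff_mul_eq_one, h b a b hab.symm.spansFace, h.self]

end IsEdgeCocycle

namespace IsSpanningTree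

variable {r : V} {p : V → V}

theorem spansEdge (h : IsSpanningTree K r p) {v : V} (hv : v ≠ r) : SpansEdge K v (p v) :=
  (h.choose_spec v hv).1

theorem induction (h : IsSpanningTree K r p) {motive : V → Prop} (root : motive r)
    (parent : ∀ v, v ≠ r → motive (p v) → motive v) (v : V) : motive v := by
  obtain ⟨d, hd⟩ := h
  induction hn : d v using Nat.strong_induction_on generalizing v with
  | _ n ih =>
    by_cases hv : v = r
    · exact hv ▸ root
    · exact parent v hv (ih _ (hn ▸ (hd v hv).2) _ rfl)

end IsSpanningTree

theorem exists_isSpanningTree_of_reflTransGen {r : V}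
    (hc : ∀ v, Relation.ReflTransGen (SpansEdge K) v r) :
    ∃ p, IsSpanningTree K r p ∧ ∀ v, v ≠ r → SpansEdge K v r → p v = r := by
  let Γ : SimpleGraph V := SimpleGraph.fromRel (SpansEdge K)
  have hadj (a b : V) : Γ.Adj a b ↔ a ≠ b ∧ SpansEdge K a b := by
    rw [SimpleGraph.fromRel_adj]
    exact and_congr_right fun _ => ⟨fun h => h.elim id SpansEdge.symm, Or.inl⟩
  have hreach (v : V) : Γ.Reachable v r := by
    induction hc v using Relation.ReflTransGen.head_induction_on with
    | refl => exact .refl r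
    | @head a b hab _ ih =>
      by_cases h : a = b
      · exact h ▸ ih
      · exact (SimpleGraph.Adj.reachable ((hadj a b).mpr ⟨h, hab⟩)).trans ih
  have hstep (v : V) (hv : v ≠ r) : ∃ u, Γ.Adj v u ∧ Γ.dist u r < Γ.dist v r := by
    obtain ⟨w, hw⟩ := (hreach v).exists_walk_length_eq_dist
    cases w with
    | nil => exact absurd rfl hv
    | cons hvu q =>
      rw [SimpleGraph.Walk.length_cons] at hw
      exact ⟨_, hvu, by have := SimpleGraph.dist_le q; omega⟩
  have : Nonempty V := ⟨r⟩
  choose! p hp using hstep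
  refine ⟨p, ⟨fun v => Γ.dist v r, fun v hv => ⟨((hadj _ _).mp (hp v hv).1).2, (hp v hv).2⟩⟩,
    fun v hv hvr => (hreach (p v)).dist_eq_zero_iff.mp ?_⟩
  have hdist : Γ.dist v r = 1 := SimpleGraph.dist_eq_one_iff_adj.mpr ((hadj _ _).mpr ⟨hv, hvr⟩)
  have := (hp v hv).2
  omega

end SimplicialComplexes

section EdgePathGroups

variable {V : Type*} (K : AbstractSimplicialComplex V) (r : V) (p : V → V)

/-- The defining relations of the edge-path group of `K` relative to a spanning tree. Every ordered
pair of vertices is a generator; the pairs that do not span an edge are killed. -/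
def edgePathRels : Set (FreeGroup (V × V)) :=
  {w | ∃ a b c, SpansFace K a b c ∧
    w = FreeGroup.of (a, b) * FreeGroup.of (b, c) * (FreeGroup.of (a, c))⁻¹} ∪
  {w | ∃ v, v ≠ r ∧ w = FreeGroup.of (v, p v)} ∪
  {w | ∃ a b, ¬ SpansEdge K a b ∧ w = FreeGroup.of (a, b)}

/-- The edge-path group of `K` relative to the spanning tree with root `r` and parent function `p`:
the group generated by the edges of `K`, subject to the triangle relations and to the triviality of
the edges of the tree. -/
abbrev EdgePathGroup : Type _ := PresentedGroup (edgePathRels K r p)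

namespace EdgePathGroup

/-- The generator of the edge-path group attached to an ordered pair of vertices. -/
def gen (a b : V) : EdgePathGroup K r p := PresentedGroup.of (a, b)

variable {K r p}

theorem isTreeCocycle_gen : IsTreeCocycle K r p (gen K r p) where
  isEdgeCocycle a b c h := mul_inv_eq_one.mp <|
    PresentedGroup.one_of_mem (rels := edgePathRels K r p) (Or.inl (Or.inl ⟨a, b, c, h, rfl⟩))
  parent_eq_one v hv := PresentedGroup.one_of_mem (Or.inl (Or.inr ⟨v, hv, rfl⟩))

theorem gen_mul_gen {a b c : V} (h : SpansFace K a b c) :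
    gen K r p a b * gen K r p b c = gen K r p a c :=
  isTreeCocycle_gen.isEdgeCocycle a b c h

theorem gen_parent {v : V} (hv : v ≠ r) : gen K r p v (p v) = 1 :=
  isTreeCocycle_gen.parent_eq_one v hv

theorem gen_of_not_spansEdge {a b : V} (h : ¬ SpansEdge K a b) : gen K r p a b = 1 :=
  PresentedGroup.one_of_mem (Or.inr ⟨a, b, h, rfl⟩)

theorem gen_self (a : V) : gen K r p a a = 1 := isTreeCocycle_gen.isEdgeCocycle.self a

theorem gen_swap (a b : V) : gen K r p b a = (gen K r p a b)⁻¹ := by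
  by_cases h : SpansEdge K a b
  · exact isTreeCocycle_gen.isEdgeCocycle.swap h
  · rw [gen_of_not_spansEdge h, gen_of_not_spansEdge fun h' => h h'.symm, inv_one]

variable {H : Type*} [Group H] {ℓ : V → V → H}

open Classical in
/-- The homomorphism out of the edge-path group with prescribed values on the edges. -/
noncomputable def lift (h : IsTreeCocycle K r p ℓ) : EdgePathGroup K r p →* H :=
  PresentedGroup.toGroup (f := fun e => if SpansEdge K e.1 e.2 then ℓ e.1 e.2 else 1) <| by
    rintro _ ((⟨a, b, c, habc, rfl⟩ | ⟨v, hv, rfl⟩) | ⟨a, b, hab, rfl⟩)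
    · simp [habc.left, habc.right, habc.outer, h.isEdgeCocycle a b c habc]
    · simp [h.parent_eq_one v hv]
    · simp [hab]

theorem lift_gen (h : IsTreeCocycle K r p ℓ) {a b : V} (hab : SpansEdge K a b) :
    lift h (gen K r p a b) = ℓ a b :=
  (PresentedGroup.toGroup.of _).trans (if_pos hab)

theorem hom_ext {f g : EdgePathGroup K r p →* H}
    (h : ∀ a b, SpansEdge K a b → f (gen K r p a b) = g (gen K r p a b)) : f = g := by
  refine PresentedGroup.ext fun ⟨a, b⟩ => ?_
  by_cases hab : SpansEdge K a b
  · exact h a b hab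
  · change f (gen K r p a b) = g (gen K r p a b)
    rw [gen_of_not_spansEdge hab, map_one, map_one]

theorem eq_top_of_gen_mem {S : Subgroup (EdgePathGroup K r p)}
    (h : ∀ a b, SpansEdge K a b → gen K r p a b ∈ S) : S = ⊤ := by
  rw [eq_top_iff, ← PresentedGroup.closure_range_of, Subgroup.closure_le]
  rintro _ ⟨⟨a, b⟩, rfl⟩
  by_cases hab : SpansEdge K a b
  · exact h a b hab
  · change gen K r p a b ∈ S
    exact gen_of_not_spansEdge hab ▸ S.one_mem

theorem nonempty_equiv_of_leftInverse {f : H →* EdgePathGroup K r p}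
    {g : EdgePathGroup K r p →* H} (hgf : g.comp f = MonoidHom.id H)
    (hf : ∀ a b, SpansEdge K a b → gen K r p a b ∈ f.range) :
    Nonempty (H ≃* EdgePathGroup K r p) :=
  ⟨MulEquiv.ofBijective f ⟨Function.LeftInverse.injective (DFunLike.congr_fun hgf),
    MonoidHom.range_eq_top.mp (eq_top_of_gen_mem hf)⟩⟩

end EdgePathGroup

end EdgePathGroups

theorem simplyConnectedSpace_of_starConvex_image_val {E : Type*} [AddCommGroup E] [Module ℝ E]
    [TopologicalSpace E] [ContinuousAdd E] [ContinuousSMul ℝ E] {R : Set E} {S : Set R} {x : E}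
    (hS : StarConvex ℝ x (Subtype.val '' S)) (hne : S.Nonempty) : SimplyConnectedSpace S := by
  have := hS.contractibleSpace (hne.image _)
  have := (Topology.IsEmbedding.subtypeVal.homeomorphImage S).contractibleSpace
  infer_instance

namespace FiniteTwoComplex

section Stars

variable (X : FiniteTwoComplex)

/-- The open star of a vertex in the geometric realization. -/
def openStar (v : X.V) : Set X.realization := {x | 0 < x.1 v}

/-- The closed simplex of the geometric realization spanned by a set of vertices. -/
def closedSimplex (s : Finset X.V) : Set X.realization := {x | ∀ v, v ∉ s → x.1 v = 0}

open Classical in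
/-- A vertex as a point of the geometric realization. -/
noncomputable def vertex (v : X.V) : X.realization :=
  ⟨Pi.single v 1, single_mem_stdSimplex ℝ v, {v}, X.K.singleton_mem v, fun w hw => by
    rw [Finset.mem_singleton] at hw
    simp [hw]⟩

/-- A chosen simplex containing a point of the geometric realization. -/
noncomputable def carrier (x : X.realization) : Finset X.V := x.2.2.choose

variable {X}

theorem carrier_mem_faces (x : X.realization) : X.carrier x ∈ X.K.faces := x.2.2.choose_spec.1

theorem mem_closedSimplex_carrier (x : X.realization) : x ∈ X.closedSimplex (X.carrier x) :=
  x.2.2.choose_spec.2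

theorem mem_of_mem_openStar {x : X.realization} {s : Finset X.V} {v : X.V}
    (hv : x ∈ X.openStar v) (hx : x ∈ X.closedSimplex s) : v ∈ s := by
  by_contra hvs
  exact (ne_of_gt hv) (hx v hvs)

theorem mem_carrier {x : X.realization} {v : X.V} (hv : x ∈ X.openStar v) : v ∈ X.carrier x :=
  mem_of_mem_openStar hv (mem_closedSimplex_carrier x)

theorem spansFace_of_mem_openStar {x : X.realization} {a b c : X.V} (ha : x ∈ X.openStar a)
    (hb : x ∈ X.openStar b) (hc : x ∈ X.openStar c) : SpansFace X.K a b c :=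
  ⟨_, carrier_mem_faces x, mem_carrier ha, mem_carrier hb, mem_carrier hc⟩

theorem isOpen_openStar (v : X.V) : IsOpen (X.openStar v) :=
  isOpen_lt continuous_const ((continuous_apply v).comp continuous_subtype_val)

theorem exists_mem_openStar (x : X.realization) : ∃ v, x ∈ X.openStar v := by
  by_contra! h
  have h0 (v : X.V) : x.1 v = 0 := le_antisymm (not_lt.mp (h v)) (x.2.1.1 v)
  simpa [h0] using x.2.1.2

/-- A chosen vertex whose open star contains the given point. -/
noncomputable def starIndex (x : X.realization) : X.V := (exists_mem_openStar x).choose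

theorem mem_openStar_starIndex (x : X.realization) : x ∈ X.openStar (starIndex x) :=
  (exists_mem_openStar x).choose_spec

open Classical in
theorem vertex_apply (v w : X.V) : (X.vertex v).1 w = if w = v then 1 else 0 := by
  simp [vertex, Pi.single_apply]

theorem vertex_mem_openStar_iff {v w : X.V} : X.vertex v ∈ X.openStar w ↔ w = v := by
  change 0 < (X.vertex v).1 w ↔ _
  rw [vertex_apply]
  split_ifs with h <;> simp [h]

theorem vertex_mem_openStar (v : X.V) : X.vertex v ∈ X.openStar v :=
  vertex_mem_openStar_iff.mpr rfl

theorem starIndex_vertex (v : X.V) : starIndex (X.vertex v) = v :=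
  vertex_mem_openStar_iff.mp (mem_openStar_starIndex _)

theorem vertex_mem_closedSimplex {v : X.V} {s : Finset X.V} (h : v ∈ s) :
    X.vertex v ∈ X.closedSimplex s := by
  intro w hw
  rw [vertex_apply, if_neg (ne_of_mem_of_not_mem h hw).symm]

theorem closedSimplex_mono {s t : Finset X.V} (h : s ⊆ t) :
    X.closedSimplex s ⊆ X.closedSimplex t :=
  fun _ hx v hv => hx v fun hvs => hv (h hvs)

theorem convex_closedSimplex {s : Finset X.V} (hs : s ∈ X.K.faces) :
    Convex ℝ (Subtype.val '' X.closedSimplex s) := by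
  rintro _ ⟨y, hy, rfl⟩ _ ⟨z, hz, rfl⟩ α β hα hβ hαβ
  have hvanish (v : X.V) (hv : v ∉ s) : (α • y.1 + β • z.1) v = 0 := by simp [hy v hv, hz v hv]
  exact ⟨⟨_, convex_stdSimplex ℝ _ y.2.1 z.2.1 hα hβ hαβ, s, hs, hvanish⟩, hvanish, rfl⟩

theorem starConvex_openStar (a : X.V) :
    StarConvex ℝ (X.vertex a).1 (Subtype.val '' X.openStar a) := by
  rintro _ ⟨y, hy, rfl⟩ α β hα hβ hαβ
  obtain ⟨z, -, hz⟩ := convex_closedSimplex (carrier_mem_faces y)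
    ⟨_, vertex_mem_closedSimplex (mem_carrier hy), rfl⟩
    ⟨_, mem_closedSimplex_carrier y, rfl⟩ hα hβ hαβ
  refine ⟨z, ?_, hz⟩
  change 0 < z.1 a
  rw [hz]
  exact convex_Ioi (0 : ℝ) (vertex_mem_openStar a) hy hα hβ hαβ

theorem simplyConnectedSpace_closedSimplex {s : Finset X.V} (hs : s ∈ X.K.faces) :
    SimplyConnectedSpace (X.closedSimplex s) := by
  obtain ⟨a, ha⟩ := X.K.isRelLowerSet_faces.prop_of_mem hs
  have hmem := vertex_mem_closedSimplex ha
  exact simplyConnectedSpace_of_starConvex_image_val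
    ((convex_closedSimplex hs).starConvex ⟨_, hmem, rfl⟩) ⟨_, hmem⟩

theorem simplyConnectedSpace_openStar (a : X.V) : SimplyConnectedSpace (X.openStar a) :=
  simplyConnectedSpace_of_starConvex_image_val (starConvex_openStar a) ⟨_, vertex_mem_openStar a⟩

theorem joinedIn_closedSimplex_inter_openStar {a : X.V} {x : X.realization}
    (hx : x ∈ X.openStar a) :
    JoinedIn (X.closedSimplex (X.carrier x) ∩ X.openStar a) (X.vertex a) x := by
  have ha : X.vertex a ∈ X.closedSimplex (X.carrier x) :=
    vertex_mem_closedSimplex (mem_carrier hx)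
  have hstar : StarConvex ℝ (X.vertex a).1
      (Subtype.val '' (X.closedSimplex (X.carrier x) ∩ X.openStar a)) := by
    rw [Set.image_inter Subtype.val_injective]
    exact ((convex_closedSimplex (carrier_mem_faces x)).starConvex ⟨_, ha, rfl⟩).inter
      (starConvex_openStar a)
  have hmem : X.vertex a ∈ X.closedSimplex (X.carrier x) ∩ X.openStar a :=
    ⟨ha, vertex_mem_openStar a⟩
  have := simplyConnectedSpace_of_starConvex_image_val hstar ⟨_, hmem⟩
  exact (isPathConnected_iff_pathConnectedSpace.mpr inferInstance).joinedIn _ hmem _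
    ⟨mem_closedSimplex_carrier x, hx⟩

open Classical in
theorem joinedIn_closedSimplex_pair {a b : X.V} (h : SpansEdge X.K a b) :
    JoinedIn (X.closedSimplex {a, b}) (X.vertex a) (X.vertex b) := by
  have := simplyConnectedSpace_closedSimplex (spansEdge_iff.mp h)
  exact (isPathConnected_iff_pathConnectedSpace.mpr inferInstance).joinedIn _
    (vertex_mem_closedSimplex (by simp)) _ (vertex_mem_closedSimplex (by simp))

theorem exists_mem_openStar_inter {a b : X.V} (h : SpansEdge X.K a b) :
    ∃ x : X.realization, x ∈ X.openStar a ∧ x ∈ X.openStar b := by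
  classical
  obtain ⟨s, hs, ha, hb⟩ := h
  obtain ⟨z, -, hz⟩ := convex_closedSimplex hs ⟨_, vertex_mem_closedSimplex ha, rfl⟩
    ⟨_, vertex_mem_closedSimplex hb, rfl⟩ (half_pos one_pos).le (half_pos one_pos).le
    (add_halves 1)
  have hcoord (v : X.V) :
      z.1 v = 1 / 2 * (if v = a then 1 else 0) + 1 / 2 * (if v = b then 1 else 0) := by
    rw [hz, ← vertex_apply, ← vertex_apply]
    rfl
  refine ⟨z, ?_, ?_⟩ <;>
  · change 0 < z.1 _
    rw [hcoord, if_pos rfl]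
    split_ifs <;> norm_num

end Stars

section Holonomy

variable {X : FiniteTwoComplex} {H : Type*} [Group H]

/-- The principal bundle over the geometric realization with discrete fibre `H` whose transition
functions between the open stars of the vertices are right translations by the labels of a
cocycle. -/
noncomputable def cocycleBundle [TopologicalSpace H] [DiscreteTopology H] {ℓ : X.V → X.V → H}
    (hℓ : IsEdgeCocycle X.K ℓ) : FiberBundleCore X.V X.realization H where
  baseSet := X.openStar
  isOpen_baseSet := isOpen_openStar
  indexAt := starIndex
  mem_baseSet_at := mem_openStar_starIndex
  coordChange v w _ h := h * ℓ v w
  coordChange_self v x _ h := by simp [hℓ.self]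
  continuousOn_coordChange v w := by fun_prop
  coordChange_comp i j k x hx h := by
    rw [mul_assoc, hℓ _ _ _ (spansFace_of_mem_openStar hx.1.1 hx.1.2 hx.2)]

theorem isCoveringMap_cocycleBundle_proj [TopologicalSpace H] [DiscreteTopology H]
    {ℓ : X.V → X.V → H} (hℓ : IsEdgeCocycle X.K ℓ) : IsCoveringMap (cocycleBundle hℓ).proj :=
  FiberBundle.isCoveringMap (F := H) (E := (cocycleBundle hℓ).Fiber)

theorem monodromy_cocycleBundle_mk [TopologicalSpace H] [DiscreteTopology H]
    {ℓ : X.V → X.V → H} (hℓ : IsEdgeCocycle X.K ℓ) (v : X.V) {x y : X.realization}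
    (γ : Path x y) (hγ : Set.range γ ⊆ X.openStar v) (h : H) :
    (isCoveringMap_cocycleBundle_proj hℓ).monodromy (.mk γ) ⟨⟨x, h⟩, rfl⟩ =
      ⟨⟨y, h * (ℓ (starIndex x) v * ℓ v (starIndex y))⟩, rfl⟩ := by
  have hγ' (t : I) : γ t ∈ X.openStar v := hγ ⟨t, rfl⟩
  have hx : x ∈ X.openStar v := by simpa using hγ' 0
  set Z := cocycleBundle hℓ
  let Γ : C(I, Z.TotalSpace) :=
    { toFun := fun t =>
        (Z.localTriv v).toOpenPartialHomeomorph.symm (γ t, h * ℓ (starIndex x) v)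
      continuous_toFun := by
        refine (Z.localTriv v).toOpenPartialHomeomorph.continuousOn_symm.comp_continuous
          (by fun_prop) fun t => ?_
        rw [FiberBundleCore.mem_localTriv_target]
        exact hγ' t }
  have hΓ (t : I) : Γ t = ⟨γ t, h * ℓ (starIndex x) v * ℓ v (starIndex (γ t))⟩ := rfl
  have h0 : γ 0 = Z.proj (⟨x, h⟩ : Z.TotalSpace) := γ.source
  have hlift : Γ = (isCoveringMap_cocycleBundle_proj hℓ).liftPath γ ⟨x, h⟩ h0 := by
    refine ((isCoveringMap_cocycleBundle_proj hℓ).eq_liftPath_iff' h0).mpr ⟨rfl, ?_⟩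
    have hstar := mem_openStar_starIndex x
    rw [hΓ, γ.source, mul_assoc, hℓ _ _ _ (spansFace_of_mem_openStar hstar hx hstar), hℓ.self,
      mul_one]
  apply Subtype.ext
  change (isCoveringMap_cocycleBundle_proj hℓ).liftPath γ ⟨x, h⟩ h0 1 = _
  rw [← hlift, hΓ, γ.target, mul_assoc]

theorem exists_monodromy_cocycleBundle_eq_mul [TopologicalSpace H] [DiscreteTopology H]
    {ℓ : X.V → X.V → H} (hℓ : IsEdgeCocycle X.K ℓ) {x y : X.realization}
    (q : Path.Homotopic.Quotient x y) :
    ∃ g : H, ∀ h : H, (isCoveringMap_cocycleBundle_proj hℓ).monodromy q ⟨⟨x, h⟩, rfl⟩ =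
      ⟨⟨y, h * g⟩, rfl⟩ := by
  refine pathClass_induction_of_isOpen_cover isOpen_openStar exists_mem_openStar
    (P := fun x y q => ∃ g : H, ∀ h : H,
      (isCoveringMap_cocycleBundle_proj hℓ).monodromy q ⟨⟨x, h⟩, rfl⟩ = ⟨⟨y, h * g⟩, rfl⟩)
    (fun v x y γ hγ => ⟨_, monodromy_cocycleBundle_mk hℓ v γ hγ⟩) ?_ q
  rintro x y z q q' ⟨g, hg⟩ ⟨g', hg'⟩
  refine ⟨g * g', fun h => ?_⟩
  rw [IsCoveringMap.monodromy_trans_apply, hg, hg', mul_assoc]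

theorem exists_holonomy {ℓ : X.V → X.V → H} (hℓ : IsEdgeCocycle X.K ℓ) :
    ∃ hol : ∀ x y : X.realization, Path.Homotopic.Quotient x y → H,
      (∀ x y z (q : Path.Homotopic.Quotient x y) (q' : Path.Homotopic.Quotient y z),
        hol x z (q.trans q') = hol x y q * hol y z q') ∧
      ∀ v x y (γ : Path x y), Set.range γ ⊆ X.openStar v →
        hol x y (.mk γ) = ℓ (starIndex x) v * ℓ v (starIndex y) := by
  let _ : TopologicalSpace H := ⊥
  have : DiscreteTopology H := ⟨rfl⟩
  choose hol hhol using
    fun x y : X.realization => exists_monodromy_cocycleBundle_eq_mul hℓ (x := x) (y := y)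
  have fiber_ext (y : X.realization) {g g' : H}
      (h : (⟨⟨y, g⟩, rfl⟩ : (cocycleBundle hℓ).proj ⁻¹' {y}) = ⟨⟨y, g'⟩, rfl⟩) : g = g' :=
    congrArg (fun e : (cocycleBundle hℓ).proj ⁻¹' {y} => (e.1.2 : H)) h
  refine ⟨hol, fun x y z q q' => fiber_ext z ?_, fun v x y γ hγ => fiber_ext y ?_⟩
  · rw [← one_mul (hol x z (q.trans q')), ← hhol, IsCoveringMap.monodromy_trans_apply, hhol, hhol,
      one_mul]
  · rw [← one_mul (hol x y _), ← hhol, monodromy_cocycleBundle_mk hℓ v γ hγ, one_mul]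

/-- The holonomy of a cocycle along a class of paths. -/
noncomputable def holonomy {ℓ : X.V → X.V → H} (hℓ : IsEdgeCocycle X.K ℓ) {x y : X.realization}
    (q : Path.Homotopic.Quotient x y) : H :=
  (exists_holonomy hℓ).choose x y q

section HolonomyLemmas

variable {ℓ : X.V → X.V → H} (hℓ : IsEdgeCocycle X.K ℓ) {x y z : X.realization}

theorem holonomy_trans (q : Path.Homotopic.Quotient x y) (q' : Path.Homotopic.Quotient y z) :
    holonomy hℓ (q.trans q') = holonomy hℓ q * holonomy hℓ q' :=
  (exists_holonomy hℓ).choose_spec.1 _ _ _ q q'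

theorem holonomy_mk_of_range_subset_openStar (v : X.V) (γ : Path x y)
    (hγ : Set.range γ ⊆ X.openStar v) :
    holonomy hℓ (.mk γ) = ℓ (starIndex x) v * ℓ v (starIndex y) :=
  (exists_holonomy hℓ).choose_spec.2 v _ _ γ hγ

theorem holonomy_refl (x : X.realization) :
    holonomy hℓ (Path.Homotopic.Quotient.refl x) = 1 := by
  simpa using holonomy_trans hℓ (Path.Homotopic.Quotient.refl x) (Path.Homotopic.Quotient.refl x)

theorem holonomy_symm (q : Path.Homotopic.Quotient x y) :
    holonomy hℓ q.symm = (holonomy hℓ q)⁻¹ := by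
  rw [eq_inv_iff_mul_eq_one, ← holonomy_trans, Path.Homotopic.Quotient.symm_trans, holonomy_refl]

end HolonomyLemmas

end Holonomy

section EdgePaths

open Path

variable {X : FiniteTwoComplex}

/-- A path along an edge of the complex. -/
noncomputable def edgePath {a b : X.V} (h : SpansEdge X.K a b) :
    Path (X.vertex a) (X.vertex b) :=
  (joinedIn_closedSimplex_pair h).somePath

/-- The homotopy class of the paths along an edge of the complex. -/
noncomputable def edgeClass {a b : X.V} (h : SpansEdge X.K a b) :
    Homotopic.Quotient (X.vertex a) (X.vertex b) :=
  .mk (edgePath h)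

/-- A path from a vertex to a point of its open star. -/
noncomputable def spoke {a : X.V} {x : X.realization} (hx : x ∈ X.openStar a) :
    Path (X.vertex a) x :=
  (joinedIn_closedSimplex_inter_openStar hx).somePath

/-- The homotopy class of the paths from a vertex to a point inside its open star. -/
noncomputable def spokeClass {a : X.V} {x : X.realization} (hx : x ∈ X.openStar a) :
    Homotopic.Quotient (X.vertex a) x :=
  .mk (spoke hx)

theorem range_edgePath_subset {a b : X.V} (h : SpansEdge X.K a b) {s : Finset X.V} (ha : a ∈ s)
    (hb : b ∈ s) : Set.range (edgePath h) ⊆ X.closedSimplex s := by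
  classical
  refine Set.range_subset_iff.mpr fun t => closedSimplex_mono ?_
    ((joinedIn_closedSimplex_pair h).somePath_mem t)
  simp [Finset.insert_subset_iff, ha, hb]

theorem range_spoke_subset_closedSimplex {a : X.V} {x : X.realization} (hx : x ∈ X.openStar a) :
    Set.range (spoke hx) ⊆ X.closedSimplex (X.carrier x) :=
  Set.range_subset_iff.mpr fun t => ((joinedIn_closedSimplex_inter_openStar hx).somePath_mem t).1

theorem range_spoke_subset_openStar {a : X.V} {x : X.realization} (hx : x ∈ X.openStar a) :
    Set.range (spoke hx) ⊆ X.openStar a :=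
  Set.range_subset_iff.mpr fun t => ((joinedIn_closedSimplex_inter_openStar hx).somePath_mem t).2

theorem edgeClass_trans {a b c : X.V} (h : SpansFace X.K a b c) :
    (edgeClass h.left).trans (edgeClass h.right) = edgeClass h.outer := by
  obtain ⟨s, hs, ha, hb, hc⟩ := id h
  have := simplyConnectedSpace_closedSimplex hs
  refine pathClass_eq_of_range_subset (X.closedSimplex s) ((edgePath h.left).trans _) _ ?_
    (range_edgePath_subset _ ha hc)
  rw [Path.trans_range]
  exact Set.union_subset (range_edgePath_subset _ ha hb) (range_edgePath_subset _ hb hc)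

theorem spokeClass_trans_symm {a b : X.V} {x : X.realization} (ha : x ∈ X.openStar a)
    (hb : x ∈ X.openStar b) (h : SpansEdge X.K a b) :
    (spokeClass ha).trans (spokeClass hb).symm = edgeClass h := by
  have := simplyConnectedSpace_closedSimplex (carrier_mem_faces x)
  refine pathClass_eq_of_range_subset (X.closedSimplex (X.carrier x))
    ((spoke ha).trans (spoke hb).symm) _ ?_
    (range_edgePath_subset _ (mem_carrier ha) (mem_carrier hb))
  rw [Path.trans_range, Path.symm_range]
  exact Set.union_subset (range_spoke_subset_closedSimplex ha)
    (range_spoke_subset_closedSimplex hb)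

theorem spokeClass_trans_mk {a : X.V} {x y : X.realization} (hx : x ∈ X.openStar a)
    (hy : y ∈ X.openStar a) (γ : Path x y) (hγ : Set.range γ ⊆ X.openStar a) :
    (spokeClass hx).trans (Homotopic.Quotient.mk γ) = spokeClass hy := by
  have := simplyConnectedSpace_openStar a
  refine pathClass_eq_of_range_subset (X.openStar a) ((spoke hx).trans γ) _ ?_
    (range_spoke_subset_openStar hy)
  rw [Path.trans_range]
  exact Set.union_subset (range_spoke_subset_openStar hx) hγ

theorem spokeClass_vertex {a : X.V} (h : X.vertex a ∈ X.openStar a) :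
    spokeClass h = Homotopic.Quotient.refl _ := by
  have := simplyConnectedSpace_openStar a
  refine pathClass_eq_of_range_subset (X.openStar a) _ (Path.refl _)
    (range_spoke_subset_openStar h) ?_
  simpa using h

theorem holonomy_spokeClass {H : Type*} [Group H] {ℓ : X.V → X.V → H}
    (hℓ : IsEdgeCocycle X.K ℓ) {a : X.V} {x : X.realization} (hx : x ∈ X.openStar a) :
    holonomy hℓ (spokeClass hx) = ℓ a (starIndex x) := by
  rw [spokeClass, holonomy_mk_of_range_subset_openStar hℓ a _ (range_spoke_subset_openStar hx),
    starIndex_vertex, hℓ.self, one_mul]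

theorem holonomy_edgeClass {H : Type*} [Group H] {ℓ : X.V → X.V → H}
    (hℓ : IsEdgeCocycle X.K ℓ) {a b : X.V} (h : SpansEdge X.K a b) :
    holonomy hℓ (edgeClass h) = ℓ a b := by
  obtain ⟨x, ha, hb⟩ := exists_mem_openStar_inter h
  have hface := spansFace_of_mem_openStar ha (mem_openStar_starIndex x) hb
  rw [← spokeClass_trans_symm ha hb, holonomy_trans, holonomy_symm, holonomy_spokeClass,
    holonomy_spokeClass, ← hℓ.swap hface.right.symm, hℓ _ _ _ hface]

end EdgePaths

section EdgePathGroup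

open Path

variable {X : FiniteTwoComplex} {r : X.V} {p : X.V → X.V}

open Classical in
/-- The homotopy class of the path from the root to a vertex along a spanning tree. -/
noncomputable def treePath (h : IsSpanningTree X.K r p) (v : X.V) :
    Homotopic.Quotient (X.vertex r) (X.vertex v) :=
  if hv : v = r then hv ▸ Homotopic.Quotient.refl _
  else (treePath h (p v)).trans (edgeClass (h.spansEdge hv).symm)
termination_by h.choose v
decreasing_by exact (h.choose_spec v hv).2

variable (h : IsSpanningTree X.K r p)

theorem treePath_root : treePath h r = Homotopic.Quotient.refl _ := by
  rw [treePath, dif_pos rfl]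

theorem treePath_of_ne {v : X.V} (hv : v ≠ r) :
    treePath h v = (treePath h (p v)).trans (edgeClass (h.spansEdge hv).symm) := by
  rw [treePath, dif_neg hv]

theorem pathConnectedSpace_of_isSpanningTree (h : IsSpanningTree X.K r p) :
    PathConnectedSpace X.realization := by
  have fromRoot (x : X.realization) : Joined (X.vertex r) x :=
    ⟨(treePath h (starIndex x)).out.trans (spoke (mem_openStar_starIndex x))⟩
  exact ⟨⟨X.vertex r⟩, fun x y => (fromRoot x).symm.trans (fromRoot y)⟩

/-- The loop at the root that runs through the spanning tree to the start of a path, then along the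
path, and back through the tree. -/
noncomputable def treeLoop {a b : X.V} (q : Homotopic.Quotient (X.vertex a) (X.vertex b)) :
    FundamentalGroup X.realization (X.vertex r) :=
  (treePath h a).trans (q.trans (treePath h b).symm)

theorem treeLoop_trans {a b c : X.V} (q : Homotopic.Quotient (X.vertex a) (X.vertex b))
    (q' : Homotopic.Quotient (X.vertex b) (X.vertex c)) :
    treeLoop h (q.trans q') = treeLoop h q' * treeLoop h q := by
  simp only [treeLoop, FundamentalGroup.mul_def, Homotopic.Quotient.trans_assoc,
    pathClass_symm_trans_cancel]

theorem treeLoop_root (q : Homotopic.Quotient (X.vertex r) (X.vertex r)) :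
    treeLoop h q = q := by
  rw [treeLoop, treePath_root, pathClass_symm_refl, Homotopic.Quotient.refl_trans,
    Homotopic.Quotient.trans_refl]

theorem treeLoop_parent {v : X.V} (hv : v ≠ r) :
    treeLoop h (edgeClass (h.spansEdge hv).symm) = 1 := by
  rw [treeLoop, ← Homotopic.Quotient.trans_assoc, ← treePath_of_ne h hv,
    Homotopic.Quotient.trans_symm]
  rfl

open Classical in
/-- The loop at the root running through an edge from `b` to `a`. The edge is reversed because the
product in Mathlib's fundamental group traverses its right factor first. -/
noncomputable def edgeLoop (a b : X.V) : FundamentalGroup X.realization (X.vertex r) :=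
  if hab : SpansEdge X.K b a then treeLoop h (edgeClass hab) else 1

theorem edgeLoop_of_spansEdge {a b : X.V} (hab : SpansEdge X.K b a) :
    edgeLoop h a b = treeLoop h (edgeClass hab) :=
  dif_pos hab

theorem isTreeCocycle_edgeLoop : IsTreeCocycle X.K r p (edgeLoop h) where
  isEdgeCocycle a b c habc := by
    rw [edgeLoop_of_spansEdge h habc.reverse.right, edgeLoop_of_spansEdge h habc.reverse.left,
      edgeLoop_of_spansEdge h habc.reverse.outer, ← treeLoop_trans, edgeClass_trans habc.reverse]
  parent_eq_one v hv := by
    rw [edgeLoop_of_spansEdge h (h.spansEdge hv).symm, treeLoop_parent h hv]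

/-- The homomorphism from the edge-path group to the fundamental group of the realization sending
an edge to its loop through the spanning tree. -/
noncomputable def edgePathGroupHom :
    EdgePathGroup X.K r p →* FundamentalGroup X.realization (X.vertex r) :=
  EdgePathGroup.lift (isTreeCocycle_edgeLoop h)

theorem edgePathGroupHom_gen {a b : X.V} (hab : SpansEdge X.K b a) :
    edgePathGroupHom h (EdgePathGroup.gen X.K r p a b) = treeLoop h (edgeClass hab) :=
  (EdgePathGroup.lift_gen _ hab.symm).trans (edgeLoop_of_spansEdge h hab)

section

variable {H : Type*} [Group H] {ℓ : X.V → X.V → H} (hℓ : IsTreeCocycle X.K r p ℓ)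

theorem holonomy_treePath (v : X.V) : holonomy hℓ.isEdgeCocycle (treePath h v) = 1 := by
  induction v using h.induction with
  | root => rw [treePath_root, holonomy_refl]
  | parent v hv ih =>
    rw [treePath_of_ne h hv, holonomy_trans, ih, holonomy_edgeClass, one_mul,
      hℓ.isEdgeCocycle.swap (h.spansEdge hv), hℓ.parent_eq_one v hv, inv_one]

theorem holonomy_treeLoop {a b : X.V} (q : Homotopic.Quotient (X.vertex a) (X.vertex b)) :
    holonomy hℓ.isEdgeCocycle (treeLoop h q) = holonomy hℓ.isEdgeCocycle q := by
  rw [treeLoop, holonomy_trans, holonomy_trans, holonomy_symm, holonomy_treePath h hℓ,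
    holonomy_treePath h hℓ, one_mul, inv_one, mul_one]

end

theorem edgePathGroupHom_injective : Function.Injective (edgePathGroupHom h) := by
  have hgen := EdgePathGroup.isTreeCocycle_gen (K := X.K) (r := r) (p := p)
  let Φ : FundamentalGroup X.realization (X.vertex r) →* EdgePathGroup X.K r p :=
    { toFun := fun q => (holonomy hgen.isEdgeCocycle q)⁻¹
      map_one' := inv_eq_one.mpr (holonomy_refl _ _)
      map_mul' := fun q q' => by
        rw [FundamentalGroup.mul_def, holonomy_trans, mul_inv_rev] }
  have hΦ : Φ.comp (edgePathGroupHom h) = MonoidHom.id _ := by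
    refine EdgePathGroup.hom_ext fun a b hab => ?_
    change (holonomy _ (edgePathGroupHom h (EdgePathGroup.gen X.K r p a b)))⁻¹ = _
    rw [edgePathGroupHom_gen h hab.symm, holonomy_treeLoop h hgen, holonomy_edgeClass,
      EdgePathGroup.gen_swap, inv_inv, MonoidHom.id_apply]
  exact Function.LeftInverse.injective (g := Φ) (DFunLike.congr_fun hΦ)

theorem treeLoop_spokeClass_mem_range {x y : X.realization} (q : Homotopic.Quotient x y)
    {a b : X.V} (hx : x ∈ X.openStar a) (hy : y ∈ X.openStar b) :
    treeLoop h ((spokeClass hx).trans (q.trans (spokeClass hy).symm)) ∈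
      (edgePathGroupHom h).range := by
  have edge_mem {a b : X.V} (hab : SpansEdge X.K a b) :
      treeLoop h (edgeClass hab) ∈ (edgePathGroupHom h).range :=
    ⟨_, edgePathGroupHom_gen h hab⟩
  revert a b
  refine pathClass_induction_of_isOpen_cover isOpen_openStar exists_mem_openStar
    (P := fun x y q => ∀ {a b : X.V} (hx : x ∈ X.openStar a) (hy : y ∈ X.openStar b),
      treeLoop h ((spokeClass hx).trans (q.trans (spokeClass hy).symm)) ∈
        (edgePathGroupHom h).range) ?_ ?_ q
  · intro v x y γ hγ a b hx hy
    have hxv : x ∈ X.openStar v := by simpa using hγ ⟨0, rfl⟩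
    have hyv : y ∈ X.openStar v := by simpa using hγ ⟨1, rfl⟩
    have hav := (spansFace_of_mem_openStar hx hxv hxv).left
    have hvb := (spansFace_of_mem_openStar hyv hy hy).left
    have hmem := mul_mem (edge_mem hvb) (edge_mem hav)
    rw [← treeLoop_trans, ← spokeClass_trans_symm hx hxv, ← spokeClass_trans_symm hyv hy,
      ← spokeClass_trans_mk hxv hyv γ hγ] at hmem
    simpa only [Homotopic.Quotient.trans_assoc, pathClass_symm_trans_cancel] using hmem
  · intro x y z q q' hq hq' a b hx hz
    have hy := mem_openStar_starIndex y
    have hmem := mul_mem (hq' hy hz) (hq hx hy)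
    rw [← treeLoop_trans] at hmem
    simpa only [Homotopic.Quotient.trans_assoc, pathClass_symm_trans_cancel] using hmem

theorem edgePathGroupHom_surjective : Function.Surjective (edgePathGroupHom h) := by
  intro q
  have hr := vertex_mem_openStar r
  have hmem := treeLoop_spokeClass_mem_range h (x := X.vertex r) (y := X.vertex r) q hr hr
  rwa [spokeClass_vertex, pathClass_symm_refl, Homotopic.Quotient.refl_trans,
    Homotopic.Quotient.trans_refl, treeLoop_root] at hmem

theorem hasFundamentalGroup_iff (h : IsSpanningTree X.K r p) {G : Type*} [Group G] :
    X.HasFundamentalGroup G ↔ Nonempty (EdgePathGroup X.K r p ≃* G) := by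
  let e : EdgePathGroup X.K r p ≃* FundamentalGroup X.realization (X.vertex r) :=
    MulEquiv.ofBijective (edgePathGroupHom h)
      ⟨edgePathGroupHom_injective h, edgePathGroupHom_surjective h⟩
  have hc := pathConnectedSpace_of_isSpanningTree h
  constructor
  · rintro ⟨-, x, ⟨f⟩⟩
    exact ⟨e.trans ((FundamentalGroup.fundamentalGroupMulEquivOfPathConnected _ x).trans f)⟩
  · rintro ⟨f⟩
    exact ⟨hc, X.vertex r, ⟨e.symm.trans f⟩⟩

end EdgePathGroup

theorem reflTransGen_spansEdge {X : FiniteTwoComplex} (hc : PathConnectedSpace X.realization)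
    (v r : X.V) : Relation.ReflTransGen (SpansEdge X.K) v r := by
  let reaches : Set X.V := {a | Relation.ReflTransGen (SpansEdge X.K) a r}
  let A : Set X.realization := ⋃ a ∈ reaches, X.openStar a
  let B : Set X.realization := ⋃ a ∈ reachesᶜ, X.openStar a
  have hAB : A = Bᶜ := by
    ext x
    simp only [A, B, Set.mem_iUnion, Set.mem_compl_iff, not_exists]
    constructor
    · rintro ⟨a, ha, hxa⟩ b hb hxb
      exact hb (Relation.ReflTransGen.head (spansFace_of_mem_openStar hxb hxa hxa).left ha)
    · intro hx
      refine ⟨starIndex x, ?_, mem_openStar_starIndex x⟩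
      by_contra hn
      exact hx _ hn (mem_openStar_starIndex x)
  have hclopen : IsClopen A :=
    ⟨hAB ▸ (isOpen_biUnion fun a _ => isOpen_openStar a).isClosed_compl,
      isOpen_biUnion fun a _ => isOpen_openStar a⟩
  have hr : X.vertex r ∈ A := Set.mem_biUnion Relation.ReflTransGen.refl (vertex_mem_openStar r)
  have hv : X.vertex v ∈ A := hclopen.eq_univ ⟨_, hr⟩ ▸ Set.mem_univ _
  obtain ⟨a, ha, hva⟩ := Set.mem_iUnion₂.mp hv
  exact (vertex_mem_openStar_iff.mp hva) ▸ ha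

end FiniteTwoComplex

section FinitePresentations

theorem freeGroup_norm_map_le {α β : Type*} [DecidableEq α] [DecidableEq β] (f : α → β)
    (x : FreeGroup α) : (FreeGroup.map f x).norm ≤ x.norm := by
  conv_lhs => rw [← FreeGroup.mk_toWord (x := x), FreeGroup.map.mk]
  exact FreeGroup.norm_mk_le.trans (by simp [FreeGroup.norm])

theorem exists_finPresentation {G : Type*} [Group G] {α ι : Type*} [Finite α] [DecidableEq α]
    [Fintype ι] (rel : ι → FreeGroup α) (e : PresentedGroup (Set.range rel) ≃* G) :
    ∃ P : FinPresentation G, P.m = Fintype.card ι ∧ P.length ≤ ∑ i, (rel i).norm := by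
  let ea := Finite.equivFin α
  let ei := Fintype.equivFin ι
  have hrange : FreeGroup.freeGroupCongr ea '' Set.range rel =
      Set.range (fun i => FreeGroup.freeGroupCongr ea (rel (ei.symm i))) := by
    rw [← Set.range_comp, ← ei.symm.surjective.range_comp]
    rfl
  refine ⟨⟨Nat.card α, Fintype.card ι, _,
    (hrange ▸ PresentedGroup.equivPresentedGroup (Set.range rel) ea).symm.trans e⟩, rfl, ?_⟩
  change ∑ i, (FreeGroup.freeGroupCongr ea (rel (ei.symm i))).norm ≤ _
  rw [← ei.symm.sum_comp (fun i => (rel i).norm)]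
  exact Finset.sum_le_sum fun i _ => freeGroup_norm_map_le _ _

theorem FinPresentation.isFreeGroup_of_m_eq_zero {G : Type*} [Group G] (P : FinPresentation G)
    (hm : P.m = 0) : IsFreeGroup G := by
  have : IsEmpty (Fin P.m) := hm ▸ Fin.isEmpty
  have hbot : Subgroup.normalClosure (Set.range P.rel) = ⊥ := by
    rw [Set.range_eq_empty, Subgroup.normalClosure_empty]
  exact IsFreeGroup.ofMulEquiv
    (((QuotientGroup.quotientMulEquivOfEq hbot).trans QuotientGroup.quotientBot).symm.trans P.equiv)

end FinitePresentations

section VertexPresentations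

variable {V : Type*} {K : AbstractSimplicialComplex V} {r : V} {p : V → V}

theorem isEdgeCocycle_of_triangles [DecidableEq V] {H : Type*} [Group H] {ℓ : V → V → H}
    (hself : ∀ a, ℓ a a = 1) (hswap : ∀ a b, SpansEdge K a b → ℓ b a = (ℓ a b)⁻¹)
    (htri : ∀ s ∈ K.faces, s.card = 3 → ∃ a b c, s = {a, b, c} ∧ ℓ a b * ℓ b c = ℓ a c) :
    IsEdgeCocycle K ℓ := by
  intro a b c habc
  by_cases hab : a = b
  · rw [hab, hself, one_mul]
  by_cases hbc : b = c
  · rw [hbc, hself, mul_one]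
  by_cases hac : a = c
  · rw [hac, hself, hswap b c (hac ▸ habc.right), inv_mul_cancel]
  have hcard : ({a, b, c} : Finset V).card = 3 := Finset.card_eq_three.mpr
    ⟨a, b, c, hab, hac, hbc, rfl⟩
  obtain ⟨x, y, z, hs, h⟩ := htri _ (spansFace_iff.mp habc) hcard
  have hxyz : SpansFace K x y z := spansFace_iff.mpr (hs ▸ spansFace_iff.mp habc)
  have ha : a ∈ ({x, y, z} : Finset V) := hs ▸ by simp
  have hb : b ∈ ({x, y, z} : Finset V) := hs ▸ by simp
  have hc : c ∈ ({x, y, z} : Finset V) := hs ▸ by simp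
  simp only [Finset.mem_insert, Finset.mem_singleton] at ha hb hc
  have hyx := hswap x y hxyz.left
  have hzy := hswap y z hxyz.right
  have hzx := hswap x z hxyz.outer
  rw [← h, mul_inv_rev] at hzx
  rcases ha with rfl | rfl | rfl <;> rcases hb with rfl | rfl | rfl <;>
    rcases hc with rfl | rfl | rfl <;> first | contradiction | skip
  · exact h
  · rw [hzy, ← h, mul_inv_cancel_right]
  · rw [hyx, ← h, inv_mul_cancel_left]
  · rw [hzx, hyx, mul_inv_cancel_left]
  · rw [hzx, hzy, inv_mul_cancel_right]
  · rw [hzy, hyx, hzx]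

variable (K r p) in
/-- The edge `ab` lies outside the spanning tree and in no triangle at the root `r`. These are the
edges whose generators survive when the triangles at `r` are used to eliminate generators. -/
def IsEssentialEdge (a b : V) : Prop :=
  SpansEdge K a b ∧ ¬ ((a ≠ r ∧ b = p a) ∨ (b ≠ r ∧ a = p b)) ∧ ¬ SpansFace K r a b

theorem IsEssentialEdge.symm {a b : V} (h : IsEssentialEdge K r p a b) :
    IsEssentialEdge K r p b a :=
  ⟨h.1.symm, fun h' => h.2.1 h'.symm, fun h' => h.2.2 h'.swap.rotate⟩

theorem isEssentialEdge_comm {a b : V} :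
    IsEssentialEdge K r p a b ↔ IsEssentialEdge K r p b a :=
  ⟨.symm, .symm⟩

theorem EdgePathGroup.gen_eq_one_of_not_isEssentialEdge
    (hstar : ∀ v, v ≠ r → SpansEdge K v r → p v = r) {a b : V}
    (h : ¬ IsEssentialEdge K r p a b) : gen K r p a b = 1 := by
  have root (v : V) (hv : SpansEdge K v r) : gen K r p r v = 1 := by
    by_cases hvr : v = r
    · rw [hvr, gen_self]
    · rw [gen_swap v r, inv_eq_one, ← gen_parent hvr, hstar v hvr hv]
  by_cases hab : SpansEdge K a b
  · by_cases hrab : SpansFace K r a b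
    · have := gen_mul_gen (r := r) (p := p) hrab
      rwa [root a hrab.left.symm, root b hrab.outer.symm, one_mul] at this
    · rcases not_not.mp fun htree => h ⟨hab, htree, hrab⟩ with ⟨har, rfl⟩ | ⟨hbr, rfl⟩
      · exact gen_parent har
      · rw [gen_swap b _, gen_parent hbr, inv_one]
  · exact gen_of_not_spansEdge hab

variable [LinearOrder V]

open Classical in
variable (K r p) in
/-- The word representing the edge from `a` to `b` in the free group on the essential edges, each
oriented from its smaller to its larger end. It is trivial if the edge is not essential. -/
noncomputable def edgeWord (a b : V) :
    FreeGroup {e : V × V // e.1 < e.2 ∧ IsEssentialEdge K r p e.1 e.2} :=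
  if h : a < b ∧ IsEssentialEdge K r p a b then FreeGroup.of ⟨(a, b), h⟩
  else if h : b < a ∧ IsEssentialEdge K r p b a then (FreeGroup.of ⟨(b, a), h⟩)⁻¹ else 1

theorem edgeWord_of_lt {a b : V} (h : a < b ∧ IsEssentialEdge K r p a b) :
    edgeWord K r p a b = FreeGroup.of ⟨(a, b), h⟩ := dif_pos h

theorem edgeWord_swap (a b : V) : edgeWord K r p b a = (edgeWord K r p a b)⁻¹ := by
  unfold edgeWord
  split_ifs with h h'
  · exact absurd h.1 h'.1.asymm
  all_goals simp only [inv_inv, inv_one]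

theorem edgeWord_self (a : V) : edgeWord K r p a a = 1 := by
  simp [edgeWord]

theorem edgeWord_of_not_isEssentialEdge {a b : V} (h : ¬ IsEssentialEdge K r p a b) :
    edgeWord K r p a b = 1 := by
  simp [edgeWord, h, isEssentialEdge_comm (a := b)]

theorem norm_edgeWord_le_one (a b : V) : (edgeWord K r p a b).norm ≤ 1 := by
  unfold edgeWord
  split_ifs <;> simp

theorem lift_edgeWord (hstar : ∀ v, v ≠ r → SpansEdge K v r → p v = r) (a b : V) :
    FreeGroup.lift (fun e => EdgePathGroup.gen K r p e.1.1 e.1.2) (edgeWord K r p a b) =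
      EdgePathGroup.gen K r p a b := by
  by_cases h : IsEssentialEdge K r p a b
  · rcases lt_trichotomy a b with hlt | rfl | hlt
    · rw [edgeWord_of_lt ⟨hlt, h⟩, FreeGroup.lift_apply_of]
    · rw [edgeWord_self, map_one, EdgePathGroup.gen_self]
    · rw [edgeWord_swap, edgeWord_of_lt ⟨hlt, h.symm⟩, map_inv, FreeGroup.lift_apply_of,
        EdgePathGroup.gen_swap b a]
  · rw [edgeWord_of_not_isEssentialEdge h, map_one,
      EdgePathGroup.gen_eq_one_of_not_isEssentialEdge hstar h]

variable (K r p) in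
/-- The boundary word of the triangle `abc` in the free group on the essential edges. -/
noncomputable def triangleWord (a b c : V) :
    FreeGroup {e : V × V // e.1 < e.2 ∧ IsEssentialEdge K r p e.1 e.2} :=
  edgeWord K r p a b * edgeWord K r p b c * (edgeWord K r p a c)⁻¹

theorem norm_triangleWord_le_three (a b c : V) : (triangleWord K r p a b c).norm ≤ 3 := by
  refine (FreeGroup.norm_mul_le _ _).trans ?_
  rw [FreeGroup.norm_inv_eq]
  exact add_le_add ((FreeGroup.norm_mul_le _ _).trans
    (add_le_add (norm_edgeWord_le_one _ _) (norm_edgeWord_le_one _ _))) (norm_edgeWord_le_one _ _)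

theorem isTreeCocycle_mk_edgeWord
    {R : Set (FreeGroup {e : V × V // e.1 < e.2 ∧ IsEssentialEdge K r p e.1 e.2})}
    (hR : ∀ s ∈ K.faces, s.card = 3 → r ∉ s →
      ∃ a b c, s = {a, b, c} ∧ triangleWord K r p a b c ∈ R) :
    IsTreeCocycle K r p fun a b => PresentedGroup.mk R (edgeWord K r p a b) where
  isEdgeCocycle := by
    refine isEdgeCocycle_of_triangles (fun a => by rw [edgeWord_self, map_one])
      (fun a b _ => by rw [edgeWord_swap, map_inv]) fun s hs hcard => ?_
    by_cases hr : r ∈ s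
    · obtain ⟨a, b, c, -, -, -, rfl⟩ := Finset.card_eq_three.mp hcard
      have trivial_on (x y : V) (hx : x ∈ ({a, b, c} : Finset V))
          (hy : y ∈ ({a, b, c} : Finset V)) : edgeWord K r p x y = 1 :=
        edgeWord_of_not_isEssentialEdge fun h => h.2.2 ⟨_, hs, hr, hx, hy⟩
      refine ⟨a, b, c, rfl, ?_⟩
      rw [trivial_on a b (by simp) (by simp), trivial_on b c (by simp) (by simp),
        trivial_on a c (by simp) (by simp), map_one, mul_one]
    · obtain ⟨a, b, c, habc, hmem⟩ := hR s hs hcard hr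
      refine ⟨a, b, c, habc, ?_⟩
      rw [← map_mul, ← mul_inv_eq_one, ← map_inv, ← map_mul]
      exact PresentedGroup.one_of_mem hmem
  parent_eq_one v hv := by
    rw [edgeWord_of_not_isEssentialEdge fun h => h.2.1 (Or.inl ⟨hv, rfl⟩), map_one]

theorem nonempty_presentedGroup_equiv_edgePathGroup
    (hstar : ∀ v, v ≠ r → SpansEdge K v r → p v = r)
    {R : Set (FreeGroup {e : V × V // e.1 < e.2 ∧ IsEssentialEdge K r p e.1 e.2})}
    (hR : ∀ w ∈ R, ∃ a b c, SpansFace K a b c ∧ w = triangleWord K r p a b c)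
    (hR' : ∀ s ∈ K.faces, s.card = 3 → r ∉ s →
      ∃ a b c, s = {a, b, c} ∧ triangleWord K r p a b c ∈ R) :
    Nonempty (PresentedGroup R ≃* EdgePathGroup K r p) := by
  let F := FreeGroup.lift fun e : {e : V × V // e.1 < e.2 ∧ IsEssentialEdge K r p e.1 e.2} =>
    EdgePathGroup.gen K r p e.1.1 e.1.2
  have hF (w) (hw : w ∈ R) : F w = 1 := by
    obtain ⟨a, b, c, habc, rfl⟩ := hR w hw
    simp only [F, triangleWord, map_mul, map_inv, lift_edgeWord hstar,
      EdgePathGroup.gen_mul_gen habc, mul_inv_cancel]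
  refine EdgePathGroup.nonempty_equiv_of_leftInverse (f := PresentedGroup.toGroup hF)
    (g := EdgePathGroup.lift (isTreeCocycle_mk_edgeWord hR')) ?_ fun a b _ =>
      ⟨PresentedGroup.mk R (edgeWord K r p a b), lift_edgeWord hstar a b⟩
  ext e
  rw [MonoidHom.comp_apply, PresentedGroup.toGroup.of, EdgePathGroup.lift_gen _ e.2.2.1,
    edgeWord_of_lt e.2]
  rfl

end VertexPresentations

namespace FiniteTwoComplex

/-- The triangles of `X` that do not contain the vertex `v`. -/
def trianglesOff (X : FiniteTwoComplex) (v : X.V) : Set (Finset X.V) :=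
  {s | s ∈ X.K.faces ∧ s.card = 3 ∧ v ∉ s}

theorem exists_finPresentation_of_vertex {X : FiniteTwoComplex} {G : Type*} [Group G]
    (hX : X.HasFundamentalGroup G) (r : X.V) : ∃ P : FinPresentation G,
      P.m = (X.trianglesOff r).ncard ∧ P.length ≤ 3 * (X.trianglesOff r).ncard := by
  classical
  obtain ⟨p, hp, hstar⟩ := exists_isSpanningTree_of_reflTransGen fun v =>
    reflTransGen_spansEdge hX.1 v r
  obtain ⟨e⟩ := (hasFundamentalGroup_iff hp).mp hX
  let _ : LinearOrder X.V := LinearOrder.lift' (Fintype.equivFin X.V) (Equiv.injective _)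
  have vertices (s : X.trianglesOff r) : ∃ a b c, s.1 = {a, b, c} := by
    obtain ⟨a, b, c, -, -, -, h⟩ := Finset.card_eq_three.mp s.2.2.1
    exact ⟨a, b, c, h⟩
  choose a b c habc using vertices
  let rel (s : X.trianglesOff r) := triangleWord X.K r p (a s) (b s) (c s)
  obtain ⟨e'⟩ : Nonempty (PresentedGroup (Set.range rel) ≃* EdgePathGroup X.K r p) := by
    refine nonempty_presentedGroup_equiv_edgePathGroup hstar ?_ fun s hs hcard hr =>
      ⟨_, _, _, habc ⟨s, hs, hcard, hr⟩, Set.mem_range_self _⟩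
    rintro _ ⟨s, rfl⟩
    exact ⟨_, _, _, spansFace_iff.mpr (habc s ▸ s.2.1), rfl⟩
  obtain ⟨P, hm, hlength⟩ := exists_finPresentation rel (e'.trans e)
  rw [← Nat.card_eq_fintype_card, Nat.card_coe_set_eq] at hm
  refine ⟨P, hm, hlength.trans <|
    (Finset.sum_le_card_nsmul _ _ 3 fun s _ => norm_triangleWord_le_three _ _ _).trans_eq ?_⟩
  rw [Finset.card_univ, ← Nat.card_eq_fintype_card, Nat.card_coe_set_eq, smul_eq_mul, mul_comm]

end FiniteTwoComplex

section CocycleExtension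

variable {V : Type*} {K K' : AbstractSimplicialComplex V} {r : V} {p : V → V}

theorem SpansEdge.mono (h : K' ≤ K) {a b : V} : SpansEdge K' a b → SpansEdge K a b :=
  fun ⟨s, hs, ha⟩ => ⟨s, h hs, ha⟩

theorem SpansFace.mono (h : K' ≤ K) {a b c : V} : SpansFace K' a b c → SpansFace K a b c :=
  fun ⟨s, hs, ha⟩ => ⟨s, h hs, ha⟩

theorem IsTreeCocycle.mono (h : K' ≤ K) {H : Type*} [Group H] {ℓ : V → V → H}
    (hℓ : IsTreeCocycle K r p ℓ) : IsTreeCocycle K' r p ℓ :=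
  ⟨fun _ _ _ habc => hℓ.isEdgeCocycle _ _ _ (habc.mono h), hℓ.parent_eq_one⟩

theorem IsSpanningTree.mono (h : K' ≤ K) : IsSpanningTree K' r p → IsSpanningTree K r p :=
  fun ⟨d, hd⟩ => ⟨d, fun v hv => ⟨(hd v hv).1.mono h, (hd v hv).2⟩⟩

theorem nonempty_edgePathGroup_equiv_of_le (hle : K' ≤ K) (hp : IsSpanningTree K' r p)
    (hdetour : ∀ a b, SpansEdge K a b → ¬ SpansEdge K' a b →
      ∃ c, SpansFace K a c b ∧ SpansEdge K' a c ∧ SpansEdge K' c b)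
    {ℓ : V → V → EdgePathGroup K' r p} (hℓ : IsEdgeCocycle K ℓ)
    (hext : ∀ a b, SpansEdge K' a b → ℓ a b = EdgePathGroup.gen K' r p a b) :
    Nonempty (EdgePathGroup K' r p ≃* EdgePathGroup K r p) := by
  have hℓ' : IsTreeCocycle K r p ℓ :=
    ⟨hℓ, fun v hv => (hext v (p v) (hp.spansEdge hv)).trans (EdgePathGroup.gen_parent hv)⟩
  have inclusion : IsTreeCocycle K' r p (EdgePathGroup.gen K r p) :=
    EdgePathGroup.isTreeCocycle_gen.mono hle
  have mem_range (a b : V) (hab : SpansEdge K' a b) :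
      EdgePathGroup.gen K r p a b ∈ (EdgePathGroup.lift inclusion).range :=
    ⟨_, EdgePathGroup.lift_gen inclusion hab⟩
  refine EdgePathGroup.nonempty_equiv_of_leftInverse (f := EdgePathGroup.lift inclusion)
    (g := EdgePathGroup.lift hℓ') (EdgePathGroup.hom_ext fun a b hab => ?_) fun a b hab => ?_
  · rw [MonoidHom.comp_apply, EdgePathGroup.lift_gen _ hab, EdgePathGroup.lift_gen _ (hab.mono hle),
      hext a b hab, MonoidHom.id_apply]
  · by_cases hab' : SpansEdge K' a b
    · exact mem_range a b hab'
    · obtain ⟨c, hacb, hac, hcb⟩ := hdetour a b hab hab'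
      rw [← EdgePathGroup.gen_mul_gen hacb]
      exact mul_mem (mem_range a c hac) (mem_range c b hcb)

end CocycleExtension

section FaceDeletion

variable {V : Type*}

/-- The subcomplex obtained by removing the face `t`, which is not a vertex, together with all
simplices containing it. -/
def deleteFace (K : AbstractSimplicialComplex V) (t : Finset V) (ht : 2 ≤ t.card) :
    AbstractSimplicialComplex V where
  faces := {s | s ∈ K.faces ∧ ¬ t ⊆ s}
  isRelLowerSet_faces s hs := ⟨K.isRelLowerSet_faces.prop_of_mem hs.1,
    fun _ hu hne => ⟨K.isRelLowerSet_faces.mem_of_le hs.1 hu hne, fun htu => hs.2 (htu.trans hu)⟩⟩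
  singleton_mem v := ⟨K.singleton_mem v,
    fun h => by have := (Finset.card_le_card h).trans_eq (Finset.card_singleton v); omega⟩

variable {K : AbstractSimplicialComplex V} {t : Finset V} {ht : 2 ≤ t.card} {a b c : V}

theorem deleteFace_le : deleteFace K t ht ≤ K := fun _ hs => hs.1

theorem spansFace_deleteFace_iff [DecidableEq V] :
    SpansFace (deleteFace K t ht) a b c ↔ SpansFace K a b c ∧ ¬ t ⊆ {a, b, c} :=
  spansFace_iff.trans (and_congr_left' spansFace_iff.symm)

theorem spansEdge_deleteFace_iff [DecidableEq V] :
    SpansEdge (deleteFace K t ht) a b ↔ SpansEdge K a b ∧ ¬ t ⊆ {a, b} :=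
  spansEdge_iff.trans (and_congr_left' spansEdge_iff.symm)

end FaceDeletion

namespace FiniteTwoComplex

variable {X : FiniteTwoComplex} {G : Type*} [Group G]

/-- The subcomplex of `X` obtained by removing the face `t` and all simplices containing it. -/
def delete (X : FiniteTwoComplex) (t : Finset X.V) (ht : 2 ≤ t.card) : FiniteTwoComplex where
  V := X.V
  K := deleteFace X.K t ht
  card_le_three s hs := X.card_le_three s hs.1

variable {t : Finset X.V} {ht : 2 ≤ t.card}

theorem numTriangles_delete_lt {s : Finset X.V} (hs : s ∈ X.K.faces) (hcard : s.card = 3)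
    (hts : t ⊆ s) : (X.delete t ht).numTriangles < X.numTriangles := by
  classical
  exact Set.ncard_lt_ncard ⟨fun u hu => ⟨hu.1.1, hu.2⟩, fun h => (h ⟨hs, hcard⟩).1.2 hts⟩
    (Set.toFinite _)

theorem HasFundamentalGroup.delete (hX : X.HasFundamentalGroup G)
    (hdetour : ∀ a b, SpansEdge X.K a b → ¬ SpansEdge (deleteFace X.K t ht) a b →
      ∃ c, SpansFace X.K a c b ∧
        SpansEdge (deleteFace X.K t ht) a c ∧ SpansEdge (deleteFace X.K t ht) c b)
    (hext : ∀ (H : Type) [Group H] (ℓ : X.V → X.V → H), IsEdgeCocycle (deleteFace X.K t ht) ℓ →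
      ∃ ℓ' : X.V → X.V → H, IsEdgeCocycle X.K ℓ' ∧
        ∀ a b, SpansEdge (deleteFace X.K t ht) a b → ℓ' a b = ℓ a b) :
    (X.delete t ht).HasFundamentalGroup G := by
  obtain ⟨r⟩ : Nonempty X.V := hX.1.nonempty.map starIndex
  have reach (v : X.V) : Relation.ReflTransGen (SpansEdge (deleteFace X.K t ht)) v r := by
    induction reflTransGen_spansEdge hX.1 v r using Relation.ReflTransGen.head_induction_on with
    | refl => exact .refl
    | @head a b hab _ ih =>
      by_cases hab' : SpansEdge (deleteFace X.K t ht) a b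
      · exact ih.head hab'
      · obtain ⟨c, -, hac, hcb⟩ := hdetour a b hab hab'
        exact (ih.head hcb).head hac
  obtain ⟨p, hp, -⟩ := exists_isSpanningTree_of_reflTransGen reach
  obtain ⟨ℓ, hℓ, hℓ'⟩ := hext _ _ (EdgePathGroup.isTreeCocycle_gen (r := r) (p := p)).isEdgeCocycle
  obtain ⟨e⟩ := nonempty_edgePathGroup_equiv_of_le deleteFace_le hp hdetour hℓ hℓ'
  obtain ⟨f⟩ := (hasFundamentalGroup_iff (hp.mono deleteFace_le)).mp hX
  exact (hasFundamentalGroup_iff (X := X.delete t ht) hp).mpr ⟨e.trans f⟩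

end FiniteTwoComplex

/-- The vertices `a`, `b` and `c` are the distinct vertices of a triangle of `K`. -/
structure IsTriangle {V : Type*} (K : AbstractSimplicialComplex V) (a b c : V) : Prop where
  spansFace : SpansFace K a b c
  ne_left : a ≠ b
  ne_right : b ≠ c
  ne_outer : a ≠ c

namespace IsTriangle

variable {V : Type*} {K : AbstractSimplicialComplex V} {a b c : V}

theorem rotate (h : IsTriangle K a b c) : IsTriangle K b c a :=
  ⟨h.spansFace.rotate, h.ne_right, h.ne_outer.symm, h.ne_left.symm⟩

theorem swap (h : IsTriangle K a b c) : IsTriangle K b a c :=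
  ⟨h.spansFace.swap, h.ne_left.symm, h.ne_outer, h.ne_right⟩

theorem flip (h : IsTriangle K a b c) : IsTriangle K a c b := h.swap.rotate

theorem two_le_card [DecidableEq V] (h : IsTriangle K a b c) : 2 ≤ ({a, b} : Finset V).card :=
  (Finset.card_pair h.ne_left).ge

variable [DecidableEq V]

theorem mem_faces (h : IsTriangle K a b c) : {a, b, c} ∈ K.faces := spansFace_iff.mp h.spansFace

theorem card_eq_three (h : IsTriangle K a b c) : ({a, b, c} : Finset V).card = 3 :=
  Finset.card_eq_three.mpr ⟨a, b, c, h.ne_left, h.ne_outer, h.ne_right, rfl⟩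

end IsTriangle

section TriangleDeletion

variable {V : Type*} [DecidableEq V] {K : AbstractSimplicialComplex V} {a b c : V}

theorem IsTriangle.detour (habc : IsTriangle K a b c) {ht : 2 ≤ ({a, b} : Finset V).card} {u v : V}
    (huv : SpansEdge K u v) (huv' : ¬ SpansEdge (deleteFace K {a, b} ht) u v) :
    SpansFace K u c v ∧ SpansEdge (deleteFace K {a, b} ht) u c ∧
      SpansEdge (deleteFace K {a, b} ht) c v := by
  have hsub : ({a, b} : Finset V) ⊆ {u, v} := by
    by_contra h
    exact huv' (spansEdge_deleteFace_iff.mpr ⟨huv, h⟩)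
  have ⟨hface, hab, hbc, hac⟩ := habc
  have hac' : SpansEdge (deleteFace K {a, b} ht) a c :=
    spansEdge_deleteFace_iff.mpr ⟨hface.outer, by simp [Finset.insert_subset_iff, hab.symm, hbc]⟩
  have hcb' : SpansEdge (deleteFace K {a, b} ht) c b :=
    spansEdge_deleteFace_iff.mpr ⟨hface.right.symm, by
      simp [Finset.insert_subset_iff, hab, hac]⟩
  simp only [Finset.insert_subset_iff, Finset.singleton_subset_iff, Finset.mem_insert,
    Finset.mem_singleton] at hsub
  obtain ⟨rfl, rfl⟩ | ⟨rfl, rfl⟩ : (u = a ∧ v = b) ∨ (u = b ∧ v = a) := by grind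
  · exact ⟨hface.rotate.rotate.swap, hac', hcb'⟩
  · exact ⟨hface.rotate, hcb'.symm, hac'.symm⟩

theorem IsTriangle.exists_isEdgeCocycle_of_deleteFace_pair (habc : IsTriangle K a b c)
    (hfree : ∀ d, IsTriangle K a b d → d = c) {ht : 2 ≤ ({a, b} : Finset V).card}
    {H : Type*} [Group H] {ℓ : V → V → H} (hℓ : IsEdgeCocycle (deleteFace K {a, b} ht) ℓ) :
    ∃ ℓ' : V → V → H, IsEdgeCocycle K ℓ' ∧
      ∀ u v, SpansEdge (deleteFace K {a, b} ht) u v → ℓ' u v = ℓ u v := by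
  classical
  let ℓ' (u v : V) : H := if SpansEdge (deleteFace K {a, b} ht) u v then ℓ u v else ℓ u c * ℓ c v
  have old {u v : V} (h : SpansEdge (deleteFace K {a, b} ht) u v) : ℓ' u v = ℓ u v := if_pos h
  have new {u v : V} (h : ¬ SpansEdge (deleteFace K {a, b} ht) u v) : ℓ' u v = ℓ u c * ℓ c v :=
    if_neg h
  refine ⟨ℓ', isEdgeCocycle_of_triangles (fun u => ?_) (fun u v huv => ?_) fun s hs hcard => ?_,
    fun _ _ => old⟩
  · rw [old (SpansEdge.refl u), hℓ.self]
  · by_cases huv' : SpansEdge (deleteFace K {a, b} ht) u v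
    · rw [old huv', old huv'.symm, hℓ.swap huv']
    · obtain ⟨-, huc, hcv⟩ := habc.detour huv huv'
      rw [new huv', new fun h => huv' h.symm, hℓ.swap huc, hℓ.swap hcv, mul_inv_rev]
  · by_cases hsub : {a, b} ⊆ s
    · obtain ⟨d, hd, hdab⟩ := Finset.exists_mem_notMem_of_card_lt_card
        (Finset.card_le_two.trans_lt (by omega : 2 < s.card) : ({a, b} : Finset V).card < s.card)
      simp only [Finset.insert_subset_iff, Finset.singleton_subset_iff] at hsub
      simp only [Finset.mem_insert, Finset.mem_singleton, not_or] at hdab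
      obtain rfl : d = c := hfree d
        ⟨⟨s, hs, hsub.1, hsub.2, hd⟩, habc.ne_left, Ne.symm hdab.2, Ne.symm hdab.1⟩
      have hs' : s = {a, d, b} := by
        refine (Finset.eq_of_subset_of_card_le ?_ ?_).symm
        · simp [Finset.insert_subset_iff, hsub, hd]
        · rw [hcard, Finset.pair_comm, habc.card_eq_three]
      have hab' : ¬ SpansEdge (deleteFace K {a, b} ht) a b := fun h =>
        (spansEdge_deleteFace_iff.mp h).2 subset_rfl
      obtain ⟨-, hac, hcb⟩ := habc.detour habc.spansFace.left hab'
      exact ⟨a, d, b, hs', by rw [old hac, old hcb, new hab']⟩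
    · obtain ⟨x, y, z, -, -, -, rfl⟩ := Finset.card_eq_three.mp hcard
      have hxyz : SpansFace (deleteFace K {a, b} ht) x y z := spansFace_iff.mpr ⟨hs, hsub⟩
      exact ⟨x, y, z, rfl, by
        rw [old hxyz.left, old hxyz.right, old hxyz.outer, hℓ x y z hxyz]⟩

theorem IsTriangle.spansEdge_deleteFace (habc : IsTriangle K a b c)
    {ht : 2 ≤ ({a, b, c} : Finset V).card} {u v : V} (h : SpansEdge K u v) :
    SpansEdge (deleteFace K {a, b, c} ht) u v := by
  refine spansEdge_deleteFace_iff.mpr ⟨h, fun hsub => ?_⟩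
  have := (Finset.card_le_card hsub).trans Finset.card_le_two
  rw [habc.card_eq_three] at this
  omega

theorem IsTriangle.isEdgeCocycle_of_deleteFace (habc : IsTriangle K a b c) {v : V}
    (hv : v ∉ ({a, b, c} : Finset V)) (hvab : SpansFace K v a b) (hvbc : SpansFace K v b c)
    (hvac : SpansFace K v a c) {ht : 2 ≤ ({a, b, c} : Finset V).card}
    {H : Type*} [Group H] {ℓ : V → V → H}
    (hℓ : IsEdgeCocycle (deleteFace K {a, b, c} ht) ℓ) : IsEdgeCocycle K ℓ := by
  refine isEdgeCocycle_of_triangles hℓ.self (fun u w h => hℓ.swap (habc.spansEdge_deleteFace h))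
    fun s hs hcard => ?_
  have coned {x y : V} (h : SpansFace K v x y) : ℓ v x * ℓ x y = ℓ v y := by
    refine hℓ _ _ _ (spansFace_deleteFace_iff.mpr ⟨h, fun hsub => hv ?_⟩)
    rw [Finset.eq_of_subset_of_card_le hsub
      (Finset.card_le_three.trans_eq habc.card_eq_three.symm)]
    simp
  by_cases hsub : {a, b, c} ⊆ s
  · refine ⟨a, b, c, (Finset.eq_of_subset_of_card_le hsub ?_).symm, ?_⟩
    · rw [hcard, habc.card_eq_three]
    · apply mul_left_cancel (a := ℓ v a)
      rw [← mul_assoc, coned hvab, coned hvbc, coned hvac]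
  · obtain ⟨x, y, z, -, -, -, rfl⟩ := Finset.card_eq_three.mp hcard
    exact ⟨x, y, z, rfl, hℓ x y z (spansFace_iff.mpr ⟨hs, hsub⟩)⟩

end TriangleDeletion

namespace FiniteTwoComplex

variable {X : FiniteTwoComplex} {G : Type*} [Group G]

variable (X G) in
/-- `X` has fundamental group `G` and, among all such complexes, the least number of triangles. -/
def IsMinimalFor : Prop :=
  X.HasFundamentalGroup G ∧
    ∀ Y : FiniteTwoComplex, Y.HasFundamentalGroup G → X.numTriangles ≤ Y.numTriangles

/-- The triangles of `X` that contain the vertex `v`. -/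
def trianglesAt (X : FiniteTwoComplex) (v : X.V) : Set (Finset X.V) :=
  {s | s ∈ X.K.faces ∧ s.card = 3 ∧ v ∈ s}

theorem ncard_trianglesAt_add_ncard_trianglesOff (v : X.V) :
    (X.trianglesAt v).ncard + (X.trianglesOff v).ncard = X.numTriangles := by
  classical
  rw [numTriangles, ← Set.ncard_union_eq (Set.disjoint_left.mpr fun s hs hs' => hs'.2.2 hs.2.2)
    (Set.toFinite _) (Set.toFinite _)]
  congr 1
  ext s
  simp only [trianglesAt, trianglesOff, Set.mem_union, Set.mem_ofPred_eq]
  tauto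

theorem IsMinimalFor.not_delete (hX : X.IsMinimalFor G) {t s : Finset X.V} {ht : 2 ≤ t.card}
    (hs : s ∈ X.K.faces) (hcard : s.card = 3) (hts : t ⊆ s) :
    ¬ (X.delete t ht).HasFundamentalGroup G :=
  fun h => (hX.2 _ h).not_gt (numTriangles_delete_lt hs hcard hts)

theorem IsMinimalFor.exists_isTriangle_ne (hX : X.IsMinimalFor G) {a b c : X.V}
    (h : IsTriangle X.K a b c) : ∃ d, d ≠ c ∧ IsTriangle X.K a b d := by
  classical
  by_contra! hfree
  replace hfree (d : X.V) (hd : IsTriangle X.K a b d) : d = c := by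
    by_contra hdc
    exact hfree d hdc hd
  refine hX.not_delete (ht := h.two_le_card) h.mem_faces h.card_eq_three
    (by simp [Finset.insert_subset_iff]) (hX.1.delete ?_ ?_)
  · exact fun u v huv huv' => ⟨c, h.detour huv huv'⟩
  · exact fun H _ ℓ hℓ => h.exists_isEdgeCocycle_of_deleteFace_pair hfree hℓ

theorem IsMinimalFor.not_tetrahedron (hX : X.IsMinimalFor G) {a b c v : X.V}
    (h : IsTriangle X.K a b c) (hab : IsTriangle X.K v a b) (hbc : IsTriangle X.K v b c)
    (hac : IsTriangle X.K v a c) : False := by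
  classical
  have hv : v ∉ ({a, b, c} : Finset X.V) := by simp [hab.ne_left, hab.ne_outer, hbc.ne_outer]
  have ht : 2 ≤ ({a, b, c} : Finset X.V).card := by simp [h.card_eq_three]
  refine hX.not_delete (ht := ht) h.mem_faces h.card_eq_three subset_rfl (hX.1.delete ?_ ?_)
  · exact fun u w huw huw' => absurd (h.spansEdge_deleteFace huw) huw'
  · exact fun H _ ℓ hℓ => ⟨ℓ, h.isEdgeCocycle_of_deleteFace hv hab.spansFace hbc.spansFace
      hac.spansFace hℓ, fun _ _ _ => rfl⟩

theorem eq_or_eq_or_eq_of_ncard_trianglesAt_le {v : X.V}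
    (hv : (X.trianglesAt v).ncard ≤ 3) {s₁ s₂ s₃ s : Finset X.V} (h₁ : s₁ ∈ X.trianglesAt v)
    (h₂ : s₂ ∈ X.trianglesAt v) (h₃ : s₃ ∈ X.trianglesAt v) (h : s ∈ X.trianglesAt v)
    (h₁₂ : s₁ ≠ s₂) (h₁₃ : s₁ ≠ s₃) (h₂₃ : s₂ ≠ s₃) : s = s₁ ∨ s = s₂ ∨ s = s₃ := by
  classical
  have heq : ({s₁, s₂, s₃} : Set (Finset X.V)) = X.trianglesAt v := by
    refine Set.eq_of_subset_of_ncard_le (by simp [Set.insert_subset_iff, h₁, h₂, h₃]) ?_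
      (Set.toFinite _)
    rwa [Set.ncard_eq_three.mpr ⟨s₁, s₂, s₃, h₁₂, h₁₃, h₂₃, rfl⟩]
  simpa [← heq] using h

theorem mem_trianglesAt [DecidableEq X.V] {a b c : X.V} (h : IsTriangle X.K a b c) :
    {a, b, c} ∈ X.trianglesAt a :=
  ⟨h.mem_faces, h.card_eq_three, by simp⟩

theorem IsMinimalFor.exists_isTriangle_isTriangle (hX : X.IsMinimalFor G) {v a b : X.V}
    (hv : (X.trianglesAt v).ncard ≤ 3) (h : IsTriangle X.K v a b) :
    ∃ d, IsTriangle X.K v a d ∧ IsTriangle X.K v b d := by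
  classical
  obtain ⟨d, hdb, hvad⟩ := hX.exists_isTriangle_ne h
  obtain ⟨e, hea, hvbe⟩ := hX.exists_isTriangle_ne h.flip
  obtain ⟨f, hfa, hvdf⟩ := hX.exists_isTriangle_ne hvad.flip
  have ⟨_, hva, hab, hvb⟩ := h
  have ⟨_, _, had, hvd⟩ := hvad
  have b_mem : b ∉ ({v, a, d} : Finset X.V) := by simp [hvb.symm, hab.symm, hdb.symm]
  have a_mem : a ∉ ({v, b, e} : Finset X.V) := by simp [hva.symm, hab, hea.symm]
  have d_mem : d ∈ ({v, d, f} : Finset X.V) := by simp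
  refine ⟨d, hvad, ?_⟩
  rcases eq_or_eq_or_eq_of_ncard_trianglesAt_le hv (mem_trianglesAt h) (mem_trianglesAt hvad)
      (mem_trianglesAt hvbe) (mem_trianglesAt hvdf)
      (ne_of_mem_of_not_mem' (by simp : b ∈ ({v, a, b} : Finset X.V)) b_mem)
      (ne_of_mem_of_not_mem' (by simp : a ∈ ({v, a, b} : Finset X.V)) a_mem)
      (ne_of_mem_of_not_mem' (by simp : a ∈ ({v, a, d} : Finset X.V)) a_mem) with heq | heq | heq
  · rw [heq] at d_mem
    simp [hvd.symm, had.symm, hdb] at d_mem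
  · have : a ∈ ({v, d, f} : Finset X.V) := heq ▸ by simp
    simp [hva.symm, had, hfa.symm] at this
  · obtain rfl : d = e := by simpa [hvd.symm, hdb, heq] using d_mem
    exact hvbe

theorem IsMinimalFor.exists_four_le_ncard_trianglesAt (hX : X.IsMinimalFor G) {v a b : X.V}
    (h : IsTriangle X.K v a b) : ∃ u, 4 ≤ (X.trianglesAt u).ncard := by
  classical
  by_contra! hdeg
  replace hdeg (u : X.V) : (X.trianglesAt u).ncard ≤ 3 := Nat.le_of_lt_succ (hdeg u)
  obtain ⟨d, hvad, hvbd⟩ := hX.exists_isTriangle_isTriangle (hdeg v) h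
  obtain ⟨e, haev, habe⟩ := hX.exists_isTriangle_isTriangle (hdeg a) h.swap
  have hvae : IsTriangle X.K v a e := haev.swap
  have ⟨_, hva, hab, hvb⟩ := h
  have b_mem : b ∉ ({v, a, d} : Finset X.V) := by simp [hvb.symm, hab.symm, hvbd.ne_right]
  have a_mem : a ∉ ({v, b, d} : Finset X.V) := by simp [hva.symm, hab, hvad.ne_right]
  have e_mem : e ∈ ({v, a, e} : Finset X.V) := by simp
  have e_ne : e ≠ v ∧ e ≠ a ∧ e ≠ b :=
    ⟨hvae.ne_outer.symm, hvae.ne_right.symm, habe.ne_right.symm⟩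
  rcases eq_or_eq_or_eq_of_ncard_trianglesAt_le (hdeg v) (mem_trianglesAt h)
      (mem_trianglesAt hvad) (mem_trianglesAt hvbd) (mem_trianglesAt hvae)
      (ne_of_mem_of_not_mem' (by simp : b ∈ ({v, a, b} : Finset X.V)) b_mem)
      (ne_of_mem_of_not_mem' (by simp : a ∈ ({v, a, b} : Finset X.V)) a_mem)
      (ne_of_mem_of_not_mem' (by simp : a ∈ ({v, a, d} : Finset X.V)) a_mem) with heq | heq | heq
  · simp [heq, e_ne] at e_mem
  · obtain rfl : e = d := by simpa [heq, e_ne] using e_mem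
    exact hX.not_tetrahedron habe h hvbd hvad
  · exact a_mem (heq ▸ by simp)

end FiniteTwoComplex

section UpperBound

variable {G : Type*} [Group G]

theorem exists_isMinimalFor (h : simplicialComplexity G ≠ ⊤) : ∃ X : FiniteTwoComplex,
    X.IsMinimalFor G ∧ simplicialComplexity G = X.numTriangles := by
  have : Nonempty {X : FiniteTwoComplex // X.HasFundamentalGroup G} := by
    by_contra hempty
    rw [not_nonempty_iff, isEmpty_subtype] at hempty
    exact h (by simp [simplicialComplexity, hempty])
  obtain ⟨⟨X, hX⟩, hmin⟩ := ENat.exists_eq_iInf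
    (fun X : {X : FiniteTwoComplex // X.HasFundamentalGroup G} => (X.1.numTriangles : ℕ∞))
  have heq : simplicialComplexity G = X.numTriangles := by
    rw [simplicialComplexity, iInf_subtype', ← hmin]
  exact ⟨X, ⟨hX, fun Y hY => by exact_mod_cast heq.symm.trans_le (iInf₂_le Y hY)⟩, heq⟩

theorem FiniteTwoComplex.exists_isTriangle_of_not_isFreeGroup {X : FiniteTwoComplex}
    (hX : X.HasFundamentalGroup G) (hG : ¬ IsFreeGroup G) : ∃ a b c, IsTriangle X.K a b c := by
  classical
  obtain ⟨x⟩ := hX.1.nonempty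
  obtain ⟨P, hm, -⟩ := exists_finPresentation_of_vertex hX (starIndex x)
  obtain ⟨s, hs, hcard, -⟩ : (X.trianglesOff (starIndex x)).Nonempty :=
    Set.nonempty_of_ncard_ne_zero fun h => hG (P.isFreeGroup_of_m_eq_zero (hm.trans h))
  obtain ⟨a, b, c, hab, hac, hbc, rfl⟩ := Finset.card_eq_three.mp hcard
  exact ⟨a, b, c, spansFace_iff.mpr hs, hab, hbc, hac⟩

theorem cComplexity_add_twelve_le (hG : ¬ IsFreeGroup G) :
    cComplexity G + 12 ≤ 3 * simplicialComplexity G := by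
  by_cases htop : simplicialComplexity G = ⊤
  · simp [htop]
  obtain ⟨X, hX, hκ⟩ := exists_isMinimalFor htop
  obtain ⟨a, b, c, habc⟩ := FiniteTwoComplex.exists_isTriangle_of_not_isFreeGroup hX.1 hG
  obtain ⟨v, hv⟩ := hX.exists_four_le_ncard_trianglesAt habc
  obtain ⟨P, -, hP⟩ := FiniteTwoComplex.exists_finPresentation_of_vertex hX.1 v
  have hsum := X.ncard_trianglesAt_add_ncard_trianglesOff v
  have hlength : P.length + 12 ≤ 3 * X.numTriangles := by omega
  calc cComplexity G + 12 ≤ P.length + 12 := by gcongr; exact iInf_le _ P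
    _ ≤ 3 * simplicialComplexity G := by rw [hκ]; exact_mod_cast hlength

end UpperBound

section Words

variable {α : Type*}

/-- The vertices of the boundary of the polygon with `3 * l.length` sides attached along the
word `l`, each letter being subdivided into three edges. The base vertex is `none`; a loop `a` has
the interior vertices `(a, false)` and `(a, true)`, in this order. -/
def outerVertex (l : List (α × Bool)) (m : ℕ) : Option (α × Bool) :=
  if m % 3 = 0 then none else l[m / 3]?.map fun x => (x.1, if m % 3 = 1 then !x.2 else x.2)

/-- The element represented by the boundary of the polygon up to its `m`-th vertex. The middle
edge of each subdivided letter carries the letter. -/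
def outerValue (l : List (α × Bool)) (m : ℕ) : FreeGroup α := FreeGroup.mk (l.take ((m + 1) / 3))

/-- The number of interior vertices used to triangulate the polygon: each of them is joined to two
consecutive sides, except that the last one may be joined to a single side. -/
def innerCount (l : List (α × Bool)) : ℕ := (3 * l.length + 1) / 2

/-- The element attached to the `j`-th interior vertex of the polygon: the value of the boundary at
the base vertex among the outer vertices `2 * j`, `2 * j + 1`, `2 * j + 2`. -/
def innerValue (l : List (α × Bool)) (j : ℕ) : FreeGroup α :=
  FreeGroup.mk (l.take ((2 * j + 2) / 3))

/-- The labels of the edges of the subdivided wedge of circles. -/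
def wedgeLabel [DecidableEq α] : Option (α × Bool) → Option (α × Bool) → FreeGroup α
  | some x, some y => if x.1 = y.1 ∧ x.2 ≠ y.2 then FreeGroup.mk [y] else 1
  | _, _ => 1

/-- The value of the boundary of the polygon at an outer vertex adjacent to the `j`-th interior
vertex. Vertices are looked up by their image in the wedge of circles, so two positions may
coincide; they then have equal values. -/
def adjacentValue [DecidableEq α] (l : List (α × Bool)) (j : ℕ)
    (v : Option (α × Bool)) : FreeGroup α :=
  if outerVertex l (2 * j) = v then outerValue l (2 * j)
  else if outerVertex l (2 * j + 1) = v then outerValue l (2 * j + 1)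
  else outerValue l (2 * j + 2)

variable {l : List (α × Bool)} {j m t : ℕ}

theorem exists_eq_three_mul_add (m : ℕ) : ∃ t, m = 3 * t ∨ m = 3 * t + 1 ∨ m = 3 * t + 2 :=
  ⟨m / 3, by omega⟩

theorem outerVertex_three_mul (l : List (α × Bool)) (t : ℕ) : outerVertex l (3 * t) = none := by
  simp [outerVertex]

theorem outerVertex_three_mul_add_one (ht : t < l.length) :
    outerVertex l (3 * t + 1) = some (l[t].1, !l[t].2) := by
  have hmod : (3 * t + 1) % 3 = 1 := by omega
  have hdiv : (3 * t + 1) / 3 = t := by omega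
  simp [outerVertex, hmod, hdiv, ht]

theorem outerVertex_three_mul_add_two (ht : t < l.length) :
    outerVertex l (3 * t + 2) = some l[t] := by
  have hmod : (3 * t + 2) % 3 = 2 := by omega
  have hdiv : (3 * t + 2) / 3 = t := by omega
  simp [outerVertex, hmod, hdiv, ht]

theorem outerVertex_ne_succ (hm : m < 3 * l.length) : outerVertex l m ≠ outerVertex l (m + 1) := by
  obtain ⟨t, rfl | rfl | rfl⟩ := exists_eq_three_mul_add m
  · simp [outerVertex_three_mul, outerVertex_three_mul_add_one (l := l) (t := t) (by omega)]
  · have ht : t < l.length := by omega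
    simp [outerVertex_three_mul_add_one ht, outerVertex_three_mul_add_two ht, Prod.ext_iff]
  · rw [show 3 * t + 2 + 1 = 3 * (t + 1) by omega, outerVertex_three_mul,
      outerVertex_three_mul_add_two (by omega)]
    exact Option.some_ne_none _

theorem outerValue_eq_of_outerVertex_eq (hm : m + 1 < 3 * l.length)
    (h : outerVertex l m = outerVertex l (m + 2)) : outerValue l m = outerValue l (m + 2) := by
  obtain ⟨t, rfl | rfl | rfl⟩ := exists_eq_three_mul_add m
  · simp [outerVertex_three_mul, outerVertex_three_mul_add_two (l := l) (t := t) (by omega)] at h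
  · rw [show 3 * t + 1 + 2 = 3 * (t + 1) by omega, outerVertex_three_mul,
      outerVertex_three_mul_add_one (by omega)] at h
    exact absurd h (Option.some_ne_none _)
  · rw [outerValue, outerValue, show (3 * t + 2 + 2 + 1) / 3 = (3 * t + 2 + 1) / 3 by omega]

theorem outerValue_three_mul (l : List (α × Bool)) (j : ℕ) :
    outerValue l (3 * ((2 * j + 2) / 3)) = innerValue l j := by
  rw [outerValue, innerValue, show (3 * ((2 * j + 2) / 3) + 1) / 3 = (2 * j + 2) / 3 by omega]

theorem innerValue_zero (l : List (α × Bool)) : innerValue l 0 = 1 := by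
  simp [innerValue, FreeGroup.one_eq_mk]

theorem three_mul_length_le (l : List (α × Bool)) : 3 * l.length ≤ 2 * innerCount l := by
  unfold innerCount
  omega

theorem two_mul_innerCount_le (l : List (α × Bool)) : 2 * innerCount l ≤ 3 * l.length + 1 := by
  unfold innerCount
  omega

theorem innerCount_pos (hl : l ≠ []) : 0 < innerCount l := by
  have := List.length_pos_iff.mpr hl
  have := three_mul_length_le l
  omega

theorem innerValue_last (hl : l ≠ []) : innerValue l (innerCount l - 1) = FreeGroup.mk l := by
  have := three_mul_length_le l
  have := innerCount_pos hl
  rw [innerValue, List.take_of_length_le (by omega)]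

variable [DecidableEq α]

theorem wedgeLabel_self (x : Option (α × Bool)) : wedgeLabel x x = 1 := by
  cases x <;> simp [wedgeLabel]

theorem wedgeLabel_none_right (x : Option (α × Bool)) : wedgeLabel x none = 1 := by
  cases x <;> rfl

theorem wedgeLabel_not (x : α × Bool) :
    wedgeLabel (some (x.1, !x.2)) (some x) = FreeGroup.mk [x] :=
  if_pos (by simp)

theorem wedgeLabel_swap (x y : Option (α × Bool)) : wedgeLabel y x = (wedgeLabel x y)⁻¹ := by
  rcases x with - | ⟨a, ε⟩ <;> rcases y with - | ⟨b, δ⟩ <;> simp only [wedgeLabel, inv_one]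
  by_cases h : a = b ∧ ε ≠ δ
  · obtain ⟨rfl, hεδ⟩ := h
    obtain rfl : ε = !δ := Bool.eq_not.mpr hεδ
    simp [FreeGroup.invRev]
  · rw [if_neg h, if_neg fun h' => h ⟨h'.1.symm, h'.2.symm⟩, inv_one]

theorem wedgeLabel_outerVertex (hm : m < 3 * l.length) :
    wedgeLabel (outerVertex l m) (outerVertex l (m + 1)) =
      (outerValue l m)⁻¹ * outerValue l (m + 1) := by
  obtain ⟨t, rfl | rfl | rfl⟩ := exists_eq_three_mul_add m
  · rw [outerVertex_three_mul, outerValue, outerValue, show (3 * t + 1 + 1) / 3 = t by omega,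
      show (3 * t + 1) / 3 = t by omega, inv_mul_cancel, wedgeLabel_swap, wedgeLabel_none_right,
      inv_one]
  · have ht : t < l.length := by omega
    rw [outerVertex_three_mul_add_one ht, outerVertex_three_mul_add_two ht, wedgeLabel_not,
      outerValue, outerValue, show (3 * t + 1 + 1) / 3 = t by omega,
      show (3 * t + 1 + 1 + 1) / 3 = t + 1 by omega, ← List.take_concat_get' _ _ ht,
      ← FreeGroup.mul_mk, inv_mul_cancel_left]
  · rw [outerValue, outerValue, show (3 * t + 2 + 1 + 1) / 3 = t + 1 by omega,
      show (3 * t + 2 + 1) / 3 = t + 1 by omega, inv_mul_cancel,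
      show 3 * t + 2 + 1 = 3 * (t + 1) by omega, outerVertex_three_mul, wedgeLabel_none_right]

theorem adjacentValue_outerVertex (h₁ : 2 * j ≤ m) (h₂ : m ≤ 2 * j + 2) (hm : m ≤ 3 * l.length) :
    adjacentValue l j (outerVertex l m) = outerValue l m := by
  obtain rfl | rfl | rfl : m = 2 * j ∨ m = 2 * j + 1 ∨ m = 2 * j + 2 := by omega
  · rw [adjacentValue, if_pos rfl]
  · rw [adjacentValue, if_neg (outerVertex_ne_succ (by omega)), if_pos rfl]
  · rw [adjacentValue, if_neg (outerVertex_ne_succ (m := 2 * j + 1) (by omega))]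
    split_ifs with h
    · exact outerValue_eq_of_outerVertex_eq (by omega) h
    · rfl

theorem adjacentValue_none (hj : j < innerCount l) : adjacentValue l j none = innerValue l j := by
  have := two_mul_innerCount_le l
  rw [← outerValue_three_mul, ← outerVertex_three_mul l ((2 * j + 2) / 3),
    adjacentValue_outerVertex (by omega) (by omega) (by omega)]

end Words

section OfTriangles

variable {V : Type*} [DecidableEq V] {τ β : Type*} (o : V) (E : β → V × V) (T : τ → V × V × V)

/-- The complex made of the triangles `T`, the edges `E`, and the edges from the base vertex `o` to
all other vertices. -/
def ofTriangles : AbstractSimplicialComplex V where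
  faces := {s | s.Nonempty ∧ ((∃ v, s ⊆ {o, v}) ∨ (∃ e, s ⊆ {(E e).1, (E e).2}) ∨
    ∃ t, s ⊆ {(T t).1, (T t).2.1, (T t).2.2})}
  isRelLowerSet_faces _ hs := ⟨hs.1, fun _ hts ht => ⟨ht,
    hs.2.imp (fun ⟨v, hv⟩ => ⟨v, hts.trans hv⟩)
      (Or.imp (fun ⟨e, he⟩ => ⟨e, hts.trans he⟩) fun ⟨t, ht⟩ => ⟨t, hts.trans ht⟩)⟩⟩
  singleton_mem v := ⟨Finset.singleton_nonempty v, Or.inl ⟨v, by simp⟩⟩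

variable {o E T}

theorem card_le_three_of_mem_ofTriangles {s : Finset V} (hs : s ∈ (ofTriangles o E T).faces) :
    s.card ≤ 3 := by
  obtain ⟨-, ⟨v, hv⟩ | ⟨e, he⟩ | ⟨t, ht⟩⟩ := hs
  · exact (Finset.card_le_card hv).trans (Finset.card_le_two.trans (by norm_num))
  · exact (Finset.card_le_card he).trans (Finset.card_le_two.trans (by norm_num))
  · exact (Finset.card_le_card ht).trans Finset.card_le_three

theorem exists_eq_of_mem_ofTriangles {s : Finset V} (hs : s ∈ (ofTriangles o E T).faces)
    (hcard : s.card = 3) : ∃ t, {(T t).1, (T t).2.1, (T t).2.2} = s := by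
  obtain ⟨-, ⟨v, hv⟩ | ⟨e, he⟩ | ⟨t, ht⟩⟩ := hs
  · have := (Finset.card_le_card hv).trans Finset.card_le_two
    omega
  · have := (Finset.card_le_card he).trans Finset.card_le_two
    omega
  · exact ⟨t, (Finset.eq_of_subset_of_card_le ht (Finset.card_le_three.trans hcard.ge)).symm⟩

theorem ncard_ofTriangles_le [Finite τ] :
    {s | s ∈ (ofTriangles o E T).faces ∧ s.card = 3}.ncard ≤ Nat.card τ := by
  rw [← Set.ncard_univ]
  refine le_trans (Set.ncard_le_ncard ?_ (Set.toFinite _)) (Set.ncard_image_le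
    (f := fun t => ({(T t).1, (T t).2.1, (T t).2.2} : Finset V)) (Set.toFinite _))
  rintro s ⟨hs, hcard⟩
  obtain ⟨t, ht⟩ := exists_eq_of_mem_ofTriangles hs hcard
  exact ⟨t, trivial, ht⟩

theorem spansEdge_ofTriangles_base (v : V) : SpansEdge (ofTriangles o E T) v o :=
  spansEdge_iff.mpr ⟨by simp, Or.inl ⟨v, by simp [Finset.pair_comm]⟩⟩

theorem spansEdge_ofTriangles (e : β) : SpansEdge (ofTriangles o E T) (E e).1 (E e).2 :=
  spansEdge_iff.mpr ⟨by simp, Or.inr (Or.inl ⟨e, by simp⟩)⟩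

theorem spansFace_ofTriangles (t : τ) :
    SpansFace (ofTriangles o E T) (T t).1 (T t).2.1 (T t).2.2 :=
  spansFace_iff.mpr ⟨by simp, Or.inr (Or.inr ⟨t, by simp⟩)⟩

theorem isSpanningTree_ofTriangles : IsSpanningTree (ofTriangles o E T) o fun _ => o :=
  ⟨fun v => if v = o then 0 else 1, fun v hv => ⟨spansEdge_ofTriangles_base v, by simp [hv]⟩⟩

theorem isTreeCocycle_ofTriangles {H : Type*} [Group H] {ℓ : V → V → H} (hself : ∀ a, ℓ a a = 1)
    (hswap : ∀ a b, ℓ b a = (ℓ a b)⁻¹) (hbase : ∀ a, ℓ a o = 1)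
    (htri : ∀ t, ℓ (T t).1 (T t).2.1 * ℓ (T t).2.1 (T t).2.2 = ℓ (T t).1 (T t).2.2) :
    IsTreeCocycle (ofTriangles o E T) o (fun _ => o) ℓ where
  isEdgeCocycle := isEdgeCocycle_of_triangles hself (fun a b _ => hswap a b) fun s hs hcard => by
    obtain ⟨t, rfl⟩ := exists_eq_of_mem_ofTriangles hs hcard
    exact ⟨_, _, _, rfl, htri t⟩
  parent_eq_one v _ := hbase v

namespace EdgePathGroup

theorem gen_ofTriangles_base (v : V) : gen (ofTriangles o E T) o (fun _ => o) v o = 1 := by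
  by_cases hv : v = o
  · rw [hv, gen_self]
  · exact gen_parent hv

theorem gen_mem_of_ofTriangles {S : Subgroup (EdgePathGroup (ofTriangles o E T) o fun _ => o)}
    (hE : ∀ e, gen _ _ _ (E e).1 (E e).2 ∈ S) (hleft : ∀ t, gen _ _ _ (T t).1 (T t).2.1 ∈ S)
    (hright : ∀ t, gen _ _ _ (T t).2.1 (T t).2.2 ∈ S) {a b : V}
    (hab : SpansEdge (ofTriangles o E T) a b) : gen _ _ _ a b ∈ S := by
  have self (v : V) : gen _ _ _ v v ∈ S := gen_self (K := ofTriangles o E T) v ▸ S.one_mem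
  have base (v : V) : gen _ _ _ v o ∈ S := gen_ofTriangles_base (E := E) (T := T) v ▸ S.one_mem
  have swap {u v : V} (h : gen _ _ _ u v ∈ S) : gen _ _ _ v u ∈ S := gen_swap u v ▸ S.inv_mem h
  have houter (t : τ) : gen _ _ _ (T t).1 (T t).2.2 ∈ S :=
    gen_mul_gen (spansFace_ofTriangles (o := o) (E := E) t) ▸ S.mul_mem (hleft t) (hright t)
  obtain ⟨s, ⟨-, ⟨v, hs⟩ | ⟨e, hs⟩ | ⟨t, hs⟩⟩, ha, hb⟩ := hab <;>
    have ha := hs ha <;> have hb := hs hb <;>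
    simp only [Finset.mem_insert, Finset.mem_singleton] at ha hb
  · rcases ha with rfl | rfl <;> rcases hb with rfl | rfl
    exacts [self _, swap (base _), base _, self _]
  · rcases ha with rfl | rfl <;> rcases hb with rfl | rfl
    exacts [self _, hE _, swap (hE _), self _]
  · rcases ha with rfl | rfl | rfl <;> rcases hb with rfl | rfl | rfl
    exacts [self _, hleft _, houter _, swap (hleft _), self _, hright _, swap (houter _),
      swap (hright _), self _]

end EdgePathGroup

end OfTriangles

section PresentationComplex

variable {α ι : Type} (w : ι → List (α × Bool))

/-- The vertices of the triangulated presentation complex: those of the subdivided wedge of circles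
and, for each relator, those interior to its polygon. -/
abbrev PresVertex : Type := Option (α × Bool) ⊕ Σ i, Fin (innerCount (w i))

/-- The indices of the triangles in the polygons of the relators: one on each side, one between
each pair of successive interior vertices, one joining the last interior vertex to the first across
the base vertex, and a fan filling the polygon formed by the interior vertices. -/
abbrev PresTriangle : Type := Σ i, Fin (3 * (w i).length) ⊕ Fin (innerCount (w i) - 1) ⊕ Unit ⊕
  Fin (innerCount (w i) - 2)

/-- The `j`-th interior vertex of the polygon of a relator (the base vertex if `j` is too large). -/
def innerVertex (i : ι) (j : ℕ) : PresVertex w :=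
  if h : j < innerCount (w i) then .inr ⟨i, j, h⟩ else .inl none

/-- The vertices of the triangles of the triangulated presentation complex. -/
def presTriangle : PresTriangle w → PresVertex w × PresVertex w × PresVertex w
  | ⟨i, .inl m⟩ => (innerVertex w i (m / 2), .inl (outerVertex (w i) m),
      .inl (outerVertex (w i) (m + 1)))
  | ⟨i, .inr (.inl j)⟩ => (innerVertex w i j, .inl (outerVertex (w i) (2 * j + 2)),
      innerVertex w i (j + 1))
  | ⟨i, .inr (.inr (.inl _))⟩ => (innerVertex w i (innerCount (w i) - 1), .inl none,
      innerVertex w i 0)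
  | ⟨i, .inr (.inr (.inr j))⟩ => (innerVertex w i 0, innerVertex w i (j + 1),
      innerVertex w i (j + 2))

/-- The edges of the triangulated presentation complex carrying the generators. -/
def presEdge (a : α) : PresVertex w × PresVertex w :=
  (.inl (some (a, false)), .inl (some (a, true)))

theorem card_presTriangle_add_card_le [Fintype ι] (hw : ∀ i, w i ≠ []) :
    Fintype.card (PresTriangle w) + Fintype.card ι ≤ 6 * ∑ i, (w i).length := by
  rw [Fintype.card_sigma, Fintype.card_eq_sum_ones, ← Finset.sum_add_distrib, Finset.mul_sum]
  refine Finset.sum_le_sum fun i _ => ?_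
  have := List.length_pos_iff.mpr (hw i)
  have := two_mul_innerCount_le (w i)
  simp only [Fintype.card_sum, Fintype.card_fin, Fintype.card_unit]
  omega

variable [DecidableEq α] [DecidableEq ι]

/-- The triangulated presentation complex: the polygons of the relators glued to a wedge of circles
indexed by the generators. -/
def presComplex : AbstractSimplicialComplex (PresVertex w) :=
  ofTriangles (.inl none) (presEdge w) (presTriangle w)

/-- The labels of the edges of the triangulated presentation complex: the differences of the values
of their endpoints. -/
def presLabel : PresVertex w → PresVertex w → FreeGroup α
  | .inl u, .inl v => wedgeLabel u v
  | .inl u, .inr ⟨i, j⟩ => (adjacentValue (w i) j u)⁻¹ * innerValue (w i) j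
  | .inr ⟨i, j⟩, .inl v => (innerValue (w i) j)⁻¹ * adjacentValue (w i) j v
  | .inr ⟨i, j⟩, .inr ⟨i', j'⟩ =>
      if i = i' then (innerValue (w i) j)⁻¹ * innerValue (w i') j' else 1

variable {w} {i : ι} {j j' m : ℕ}

theorem presLabel_self (a : PresVertex w) : presLabel w a a = 1 := by
  rcases a with u | ⟨i, j⟩
  · exact wedgeLabel_self u
  · simp [presLabel]

theorem presLabel_swap (a b : PresVertex w) : presLabel w b a = (presLabel w a b)⁻¹ := by
  rcases a with u | ⟨i, j⟩ <;> rcases b with v | ⟨i', j'⟩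
  · exact wedgeLabel_swap u v
  · simp [presLabel]
  · simp [presLabel]
  · by_cases h : i = i'
    · simp [presLabel, h]
    · simp [presLabel, h, Ne.symm h]

theorem presLabel_base (a : PresVertex w) : presLabel w a (.inl none) = 1 := by
  rcases a with u | ⟨i, j⟩
  · exact wedgeLabel_none_right u
  · simp [presLabel, adjacentValue_none j.2]

theorem presLabel_inner_outer (hj : j < innerCount (w i)) (h₁ : 2 * j ≤ m) (h₂ : m ≤ 2 * j + 2)
    (hm : m ≤ 3 * (w i).length) :
    presLabel w (innerVertex w i j) (.inl (outerVertex (w i) m)) =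
      (innerValue (w i) j)⁻¹ * outerValue (w i) m := by
  rw [innerVertex, dif_pos hj]
  simp [presLabel, adjacentValue_outerVertex h₁ h₂ hm]

theorem presLabel_inner_inner (hj : j < innerCount (w i)) (hj' : j' < innerCount (w i)) :
    presLabel w (innerVertex w i j) (innerVertex w i j') =
      (innerValue (w i) j)⁻¹ * innerValue (w i) j' := by
  rw [innerVertex, innerVertex, dif_pos hj, dif_pos hj']
  simp [presLabel]

theorem map_presLabel_presTriangle {H : Type*} [Group H] {f : FreeGroup α →* H}
    (hf : ∀ i, f (FreeGroup.mk (w i)) = 1) (hw : ∀ i, w i ≠ []) (t : PresTriangle w) :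
    f (presLabel w (presTriangle w t).1 (presTriangle w t).2.1) *
      f (presLabel w (presTriangle w t).2.1 (presTriangle w t).2.2) =
      f (presLabel w (presTriangle w t).1 (presTriangle w t).2.2) := by
  obtain ⟨i, t⟩ := t
  have hle := two_mul_innerCount_le (w i)
  have hge := three_mul_length_le (w i)
  have hpos := innerCount_pos (hw i)
  rcases t with m | j | _ | j <;> simp only [presTriangle]
  · rw [← map_mul, presLabel_inner_outer (by omega) (by omega) (by omega) (by omega),
      presLabel_inner_outer (by omega) (by omega) (by omega) (by omega),
      show presLabel w (.inl _) (.inl _) = _ from wedgeLabel_outerVertex m.2]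
    group
  · rw [← map_mul, presLabel_inner_outer (by omega) (by omega) (by omega) (by omega),
      presLabel_inner_inner (by omega) (by omega), presLabel_swap (innerVertex w i (j + 1)),
      presLabel_inner_outer (by omega) (by omega) (by omega) (by omega)]
    group
  · rw [presLabel_base, presLabel_swap _ (.inl none), presLabel_base,
      presLabel_inner_inner (by omega) hpos, innerValue_zero, innerValue_last (hw i)]
    simp only [mul_one, map_inv, map_one, hf, inv_one]
  · rw [← map_mul, presLabel_inner_inner (by omega) (by omega),
      presLabel_inner_inner (by omega) (by omega), presLabel_inner_inner (by omega) (by omega)]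
    group

variable (w) in
/-- The edge-path group of the triangulated presentation complex, relative to the tree of the edges
at the base vertex. -/
abbrev PresEdgePathGroup : Type := EdgePathGroup (presComplex w) (.inl none) fun _ => .inl none

variable (w) in
/-- The generators of the edge-path group of the triangulated presentation complex. -/
def presGen (a b : PresVertex w) : PresEdgePathGroup w := EdgePathGroup.gen _ _ _ a b

variable (w) in
/-- The map from the free group on the generators of a presentation to the edge-path group of its
triangulated presentation complex. -/
def presHom : FreeGroup α →* PresEdgePathGroup w :=
  FreeGroup.lift fun a => presGen w (presEdge w a).1 (presEdge w a).2

theorem presGen_swap (a b : PresVertex w) : presGen w b a = (presGen w a b)⁻¹ :=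
  EdgePathGroup.gen_swap a b

theorem presGen_base (a : PresVertex w) : presGen w a (.inl none) = 1 :=
  EdgePathGroup.gen_ofTriangles_base a

theorem presGen_base_left (a : PresVertex w) : presGen w (.inl none) a = 1 := by
  rw [presGen_swap, presGen_base, inv_one]

theorem presGen_presTriangle (t : PresTriangle w) :
    presGen w (presTriangle w t).1 (presTriangle w t).2.1 *
      presGen w (presTriangle w t).2.1 (presTriangle w t).2.2 =
    presGen w (presTriangle w t).1 (presTriangle w t).2.2 :=
  EdgePathGroup.gen_mul_gen (spansFace_ofTriangles t)

theorem presHom_mk_singleton (x : α × Bool) :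
    presHom w (FreeGroup.mk [x]) = presGen w (.inl (some (x.1, !x.2))) (.inl (some x)) := by
  obtain ⟨a, - | -⟩ := x
  · rw [show FreeGroup.mk [(a, false)] = (FreeGroup.of a)⁻¹ from rfl, map_inv, presGen_swap]
    exact congrArg Inv.inv FreeGroup.lift_apply_of
  · exact FreeGroup.lift_apply_of

theorem presGen_outer (hm : m < 3 * (w i).length) :
    presGen w (.inl (outerVertex (w i) m)) (.inl (outerVertex (w i) (m + 1))) =
      presHom w ((outerValue (w i) m)⁻¹ * outerValue (w i) (m + 1)) := by
  rw [← wedgeLabel_outerVertex hm]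
  obtain ⟨t, rfl | rfl | rfl⟩ := exists_eq_three_mul_add m
  · rw [outerVertex_three_mul, presGen_base_left, wedgeLabel_swap, wedgeLabel_none_right, inv_one,
      map_one]
  · have ht : t < (w i).length := by omega
    rw [outerVertex_three_mul_add_one ht, outerVertex_three_mul_add_two ht, wedgeLabel_not,
      presHom_mk_singleton]
  · rw [show 3 * t + 2 + 1 = 3 * (t + 1) by omega, outerVertex_three_mul, wedgeLabel_none_right,
      presGen_base, map_one]

theorem presGen_inner_outer_succ (hm : m < 3 * (w i).length) :
    presGen w (innerVertex w i (m / 2)) (.inl (outerVertex (w i) (m + 1))) *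
        (presHom w (outerValue (w i) (m + 1)))⁻¹ =
      presGen w (innerVertex w i (m / 2)) (.inl (outerVertex (w i) m)) *
        (presHom w (outerValue (w i) m))⁻¹ := by
  have htri : presGen w (innerVertex w i (m / 2)) (.inl (outerVertex (w i) m)) *
      presGen w (.inl (outerVertex (w i) m)) (.inl (outerVertex (w i) (m + 1))) =
      presGen w (innerVertex w i (m / 2)) (.inl (outerVertex (w i) (m + 1))) :=
    presGen_presTriangle ⟨i, .inl ⟨m, hm⟩⟩
  rw [← htri, presGen_outer hm, map_mul, map_inv]
  group

theorem presGen_inner_outer (hj : j < innerCount (w i)) (h₁ : 2 * j ≤ m) (h₂ : m ≤ 2 * j + 2)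
    (hm : m ≤ 3 * (w i).length) :
    presGen w (innerVertex w i j) (.inl (outerVertex (w i) m)) =
      presHom w ((innerValue (w i) j)⁻¹ * outerValue (w i) m) := by
  let defect (n : ℕ) : PresEdgePathGroup w :=
    presGen w (innerVertex w i j) (.inl (outerVertex (w i) n)) * (presHom w (outerValue (w i) n))⁻¹
  have hconst (n : ℕ) (hn : 2 * j ≤ n) :
      n ≤ 2 * j + 2 → n ≤ 3 * (w i).length → defect n = defect (2 * j) := by
    induction n, hn using Nat.le_induction with
    | base => exact fun _ _ => rfl
    | succ n hn ih =>
      intro hn₂ hn₃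
      obtain rfl : n / 2 = j := by omega
      exact (presGen_inner_outer_succ (by omega)).trans (ih (by omega) (by omega))
  have hle := two_mul_innerCount_le (w i)
  have hbase : defect (3 * ((2 * j + 2) / 3)) = (presHom w (innerValue (w i) j))⁻¹ := by
    simp only [defect]
    rw [outerVertex_three_mul, presGen_base, outerValue_three_mul, one_mul]
  have hdefect : defect m = (presHom w (innerValue (w i) j))⁻¹ := by
    rw [hconst m h₁ h₂ hm, ← hbase]
    exact (hconst _ (by omega) (by omega) (by omega)).symm
  rw [map_mul, map_inv, ← hdefect, inv_mul_cancel_right]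

theorem presGen_inner_succ (hj : j + 1 < innerCount (w i)) :
    presGen w (innerVertex w i j) (innerVertex w i (j + 1)) =
      presHom w ((innerValue (w i) j)⁻¹ * innerValue (w i) (j + 1)) := by
  have htri : presGen w (innerVertex w i j) (.inl (outerVertex (w i) (2 * j + 2))) *
      presGen w (.inl (outerVertex (w i) (2 * j + 2))) (innerVertex w i (j + 1)) =
      presGen w (innerVertex w i j) (innerVertex w i (j + 1)) :=
    presGen_presTriangle ⟨i, .inr (.inl ⟨j, by omega⟩)⟩
  have hle := two_mul_innerCount_le (w i)
  rw [← htri, presGen_swap (innerVertex w i (j + 1)),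
    presGen_inner_outer (by omega) (by omega) (by omega) (by omega),
    presGen_inner_outer hj (by omega) (by omega) (by omega), ← map_inv, ← map_mul]
  group

theorem presGen_inner_zero (hj : j < innerCount (w i)) :
    presGen w (innerVertex w i 0) (innerVertex w i j) = presHom w (innerValue (w i) j) := by
  induction j with
  | zero => rw [innerValue_zero, map_one]; exact EdgePathGroup.gen_self _
  | succ j ih =>
    rcases j with - | j
    · rw [presGen_inner_succ hj, innerValue_zero, inv_one, one_mul]
    · have htri : presGen w (innerVertex w i 0) (innerVertex w i (j + 1)) *
          presGen w (innerVertex w i (j + 1)) (innerVertex w i (j + 2)) =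
          presGen w (innerVertex w i 0) (innerVertex w i (j + 2)) :=
        presGen_presTriangle ⟨i, .inr (.inr (.inr ⟨j, by omega⟩))⟩
      rw [← htri, ih (by omega), presGen_inner_succ hj, ← map_mul, mul_inv_cancel_left]

theorem presHom_mk_eq_one (hi : w i ≠ []) : presHom w (FreeGroup.mk (w i)) = 1 := by
  have hpos := innerCount_pos hi
  have hclosing : presGen w (innerVertex w i (innerCount (w i) - 1)) (.inl none) *
      presGen w (.inl none) (innerVertex w i 0) =
      presGen w (innerVertex w i (innerCount (w i) - 1)) (innerVertex w i 0) :=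
    presGen_presTriangle ⟨i, .inr (.inr (.inl ()))⟩
  rw [presGen_base, presGen_base_left, presGen_swap (innerVertex w i 0),
    presGen_inner_zero (by omega), innerValue_last hi, one_mul] at hclosing
  exact inv_eq_one.mp hclosing.symm

theorem presGen_mem_range_presHom {a b : PresVertex w} (hab : SpansEdge (presComplex w) a b) :
    presGen w a b ∈ (presHom w).range := by
  refine EdgePathGroup.gen_mem_of_ofTriangles (o := .inl none) (E := presEdge w)
    (T := presTriangle w) (fun a => ?_) (fun ⟨i, t⟩ => ?_) (fun ⟨i, t⟩ => ?_) hab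
  · exact ⟨.of a, FreeGroup.lift_apply_of⟩
  · change presGen w _ _ ∈ (presHom w).range
    have hle := two_mul_innerCount_le (w i)
    have hge := three_mul_length_le (w i)
    rcases t with m | j | _ | j
    · exact ⟨_, (presGen_inner_outer (by omega) (by omega) (by omega) (by omega)).symm⟩
    · exact ⟨_, (presGen_inner_outer (by omega) (by omega) (by omega) (by omega)).symm⟩
    · exact ⟨1, (presGen_base _).symm⟩
    · exact ⟨_, (presGen_inner_zero (by omega)).symm⟩
  · change presGen w _ _ ∈ (presHom w).range
    have hle := two_mul_innerCount_le (w i)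
    rcases t with m | j | _ | j
    · exact ⟨_, (presGen_outer m.2).symm⟩
    · change presGen w (.inl _) (innerVertex w i (j + 1)) ∈ (presHom w).range
      rw [presGen_swap (innerVertex w i (j + 1))]
      exact inv_mem ⟨_, (presGen_inner_outer (by omega) (by omega) (by omega) (by omega)).symm⟩
    · exact ⟨1, (presGen_base_left _).symm⟩
    · exact ⟨_, (presGen_inner_succ (by omega)).symm⟩

theorem nonempty_presentedGroup_equiv_presEdgePathGroup (hw : ∀ i, w i ≠ []) :
    Nonempty (PresentedGroup (Set.range fun i => FreeGroup.mk (w i)) ≃* PresEdgePathGroup w) := by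
  let π : FreeGroup α →* PresentedGroup (Set.range fun i => FreeGroup.mk (w i)) :=
    PresentedGroup.mk _
  have hπ (i : ι) : π (FreeGroup.mk (w i)) = 1 := PresentedGroup.one_of_mem ⟨i, rfl⟩
  have hlabel : IsTreeCocycle (presComplex w) (.inl none) (fun _ => .inl none)
      fun a b => π (presLabel w a b) :=
    isTreeCocycle_ofTriangles (fun a => by rw [presLabel_self, map_one])
      (fun a b => by rw [presLabel_swap, map_inv]) (fun a => by rw [presLabel_base, map_one])
      (map_presLabel_presTriangle hπ hw)
  let f : PresentedGroup (Set.range fun i => FreeGroup.mk (w i)) →* PresEdgePathGroup w :=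
    PresentedGroup.toGroup (f := fun a => presGen w (presEdge w a).1 (presEdge w a).2) <| by
      rintro _ ⟨i, rfl⟩
      exact presHom_mk_eq_one (hw i)
  have hfπ (x : FreeGroup α) : f (π x) = presHom w x := rfl
  refine EdgePathGroup.nonempty_equiv_of_leftInverse (f := f) (g := EdgePathGroup.lift hlabel)
    (PresentedGroup.ext fun a => ?_) fun a b hab => ?_
  · change EdgePathGroup.lift hlabel (f (π (FreeGroup.of a))) = π (FreeGroup.of a)
    rw [hfπ, presHom, FreeGroup.lift_apply_of]
    exact (EdgePathGroup.lift_gen hlabel (spansEdge_ofTriangles a)).trans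
      (congrArg π (wedgeLabel_not (a, true)))
  · obtain ⟨x, hx⟩ := presGen_mem_range_presHom hab
    exact ⟨π x, hx⟩

end PresentationComplex

theorem exists_hasFundamentalGroup_presentedGroup {α ι : Type} [Finite α] [Fintype ι]
    (w : ι → List (α × Bool)) (hw : ∀ i, w i ≠ []) :
    ∃ X : FiniteTwoComplex,
      X.HasFundamentalGroup (PresentedGroup (Set.range fun i => FreeGroup.mk (w i))) ∧
      X.numTriangles + Fintype.card ι ≤ 6 * ∑ i, (w i).length := by
  classical
  have := Fintype.ofFinite α
  let X : FiniteTwoComplex :=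
    ⟨PresVertex w, presComplex w, fun _ => card_le_three_of_mem_ofTriangles⟩
  have htree : IsSpanningTree X.K (.inl none) fun _ => .inl none := isSpanningTree_ofTriangles
  obtain ⟨e⟩ := nonempty_presentedGroup_equiv_presEdgePathGroup hw
  refine ⟨X, (FiniteTwoComplex.hasFundamentalGroup_iff htree).mpr ⟨e.symm⟩, ?_⟩
  have hnum : X.numTriangles ≤ Fintype.card (PresTriangle w) :=
    ncard_ofTriangles_le.trans Nat.card_eq_fintype_card.le
  exact (Nat.add_le_add_right hnum _).trans (card_presTriangle_add_card_le w hw)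

section LowerBound

variable {G : Type*} [Group G]

namespace FinPresentation

theorem exists_words (P : FinPresentation G) : ∃ (ι : Type) (_ : Fintype ι)
    (w : ι → List (Fin P.n × Bool)), (∀ i, w i ≠ []) ∧ ∑ i, (w i).length ≤ P.length ∧
      Nonempty (PresentedGroup (Set.range fun i => FreeGroup.mk (w i)) ≃* G) := by
  classical
  have hmk (i : Fin P.m) : FreeGroup.mk (P.rel i).toWord = P.rel i := FreeGroup.mk_toWord
  refine ⟨{i : Fin P.m // P.rel i ≠ 1}, inferInstance, fun i => (P.rel i).toWord,
    fun i hi => i.2 (FreeGroup.toWord_eq_nil_iff.mp hi), ?_, ⟨MulEquiv.trans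
      (QuotientGroup.quotientMulEquivOfEq (le_antisymm ?_ ?_)) P.equiv⟩⟩
  · calc ∑ i : {i // P.rel i ≠ 1}, (P.rel i).norm
        = ∑ i with P.rel i ≠ 1, (P.rel i).norm :=
        (Finset.sum_subtype (F := inferInstance) (p := fun i => P.rel i ≠ 1)
          (Finset.univ.filter fun i => P.rel i ≠ 1) (by simp) fun i => (P.rel i).norm).symm
      _ ≤ P.length := Finset.sum_le_sum_of_subset (Finset.filter_subset _ _)
  · refine Subgroup.normalClosure_mono ?_
    rintro _ ⟨i, rfl⟩
    exact ⟨i, (hmk i).symm⟩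
  · refine Subgroup.normalClosure_le_normal ?_
    rintro _ ⟨i, rfl⟩
    by_cases hi : P.rel i = 1
    · rw [hi]
      exact one_mem _
    · exact Subgroup.subset_normalClosure ⟨⟨i, hi⟩, hmk i⟩

end FinPresentation

theorem simplicialComplexity_add_minRelators_le :
    simplicialComplexity G + minRelators G ≤ 6 * cComplexity G := by
  classical
  rcases isEmpty_or_nonempty (FinPresentation G) with _ | _
  · simp [cComplexity]
  obtain ⟨P, hP⟩ := ENat.exists_eq_iInf (fun P : FinPresentation G => (P.length : ℕ∞))
  obtain ⟨ι, _, w, hw, hlength, ⟨e⟩⟩ := P.exists_words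
  obtain ⟨X, ⟨hconn, x, ⟨f⟩⟩, hcard⟩ := exists_hasFundamentalGroup_presentedGroup w hw
  obtain ⟨Q, hQ, -⟩ := exists_finPresentation _ e
  have hsum : X.numTriangles + Q.m ≤ 6 * P.length := by omega
  calc simplicialComplexity G + minRelators G
      ≤ X.numTriangles + Q.m :=
        add_le_add (iInf₂_le X ⟨hconn, x, ⟨f.trans e⟩⟩) (iInf_le _ Q)
    _ ≤ 6 * P.length := by exact_mod_cast hsum
    _ = 6 * cComplexity G := by rw [hP, cComplexity]

end LowerBound

theorem toEReal_add_div_six_le {a b c : ℕ∞} (h : a + b ≤ 6 * c) :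
    (((a : ℝ≥0∞) : EReal) + ((b : ℝ≥0∞) : EReal)) / 6 ≤ ((c : ℝ≥0∞) : EReal) := by
  have six_ne_top : (6 : EReal) ≠ ⊤ := EReal.natCast_ne_top 6
  have coe_six : ((6 : ℝ≥0∞) : EReal) = 6 := rfl
  have hcoe : (((a + b : ℕ∞) : ℝ≥0∞) : EReal) ≤ ((6 * c : ℕ∞) : ℝ≥0∞) := by exact_mod_cast h
  rw [EReal.div_le_iff_le_mul (by norm_num) six_ne_top]
  simpa [coe_six] using hcoe

theorem toEReal_le_three_mul_sub_four {a b : ℕ∞} (h : a + 12 ≤ 3 * b) :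
    ((a : ℝ≥0∞) : EReal) ≤ 3 * (((b : ℝ≥0∞) : EReal) - 4) := by
  have three_ne_top : (3 : EReal) ≠ ⊤ := EReal.natCast_ne_top 3
  have coe_three : ((3 : ℝ≥0∞) : EReal) = 3 := rfl
  have coe_twelve : ((12 : ℝ≥0∞) : EReal) = 3 * 4 := by
    rw [show (12 : ℝ≥0∞) = 3 * 4 by norm_num, EReal.coe_ennreal_mul]
    rfl
  have hcoe : (((a + 12 : ℕ∞) : ℝ≥0∞) : EReal) ≤ ((3 * b : ℕ∞) : ℝ≥0∞) := by exact_mod_cast h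
  rw [EReal.mul_sub_of_nonneg_of_ne_top (by norm_num) three_ne_top, ← coe_twelve,
    EReal.le_sub_iff_add_le (by simp) (by simp)]
  simpa [coe_three] using hcoe

/-- Both inequalities are between extended real numbers, so that the subtraction `κ(G) - 4` is not
truncated at `0`. -/
theorem mainTheorem6 (G : Type*) [Group G] :
    (((simplicialComplexity G : ℝ≥0∞) : EReal) + ((minRelators G : ℝ≥0∞) : EReal)) / 6
        ≤ ((cComplexity G : ℝ≥0∞) : EReal) ∧
    (¬ IsFreeGroup G →
      ((cComplexity G : ℝ≥0∞) : EReal)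
        ≤ 3 * (((simplicialComplexity G : ℝ≥0∞) : EReal) - 4)) :=
  ⟨toEReal_add_div_six_le simplicialComplexity_add_minRelators_le,
    fun hG => toEReal_le_three_mul_sub_four (cComplexity_add_twelve_le hG)⟩
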